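/- Let $\mathcal H_A,\mathcal H_B$ be finite-dimensional complex Hilbert spaces, $D_A=\dim\mathcal H_A$, let $H$ be a Hermitian operator on $\mathcal H_A\otimes\mathcal H_B$, $|\Psi_0\rangle$ a unit vector, $|\Psi(t)\rangle=e^{-iHt}|\Psi_0\rangle$, and let $\{|x_B\rangle\}$ be an orthonormal basis of $\mathcal H_B$. For each distinct eigenvalue $E$ of $H$ let $c_E|E\rangle$ (with $|E\rangle$ a unit vector) be the orthogonal projection of $|\Psi_0\rangle$ to the eigenspace of $E$, and put $$\rho_d=\sum_E|c_E|^2|E\rangle\langle E|,\qquad \rho_d^{(2)}=\sum_E|c_E|^4|E,E\rangle\langle E,E|,$$ $$|\tilde\Psi(x_B,t)\rangle=(\mathbb I_A\otimes\langle x_B|)|\Psi(t)\rangle,\qquad p_d(x_B)=\mathrm{tr}\big[(\mathbb I_A\otimes\langle x_B|)\rho_d(\mathbb I_A\otimes|x_B\rangle)\big],$$ $$\bar\rho(x_B)=\frac{(\mathbb I_A\otimes\langle x_B|)\rho_d(\mathbb I_A\otimes|x_B\rangle)}{p_d(x_B)},$$ $$\Delta_\beta(x_B)=\frac{\mathrm{tr}\big[(\mathbb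 I_A\otimes|x_B\rangle\langle x_B|)^{\otimes2}\rho_d^{(2)}\big]}{p_d(x_B)^2},\qquad \Delta_\beta=\sum_{x_B}p_d(x_B)\Delta_\beta(x_B),$$ where all sums over $x_B$ run over the outcomes with $p_d(x_B)>0$. For a density matrix $\rho$ on $\mathcal H_A$ with eigensystem $(\lambda_m,|m\rangle)$, let $\tilde\rho^{(k)}_{\tilde{\mathrm S}\mathrm{cr.}}[\rho]=\mathbb E\big[(|\tilde\Psi\rangle\langle\tilde\Psi|)^{\otimes k}\big]$, where $|\tilde\Psi\rangle=\sum_m g_m|m\rangle$ with independent centred complex Gaussian variables $g_m$ of density $\frac1{\pi\lambda_m}e^{-|g|^2/\lambda_m}$ ($g_m=0$ if $\lambda_m=0$): the unnormalized Scrooge ensemble of $\rho$. For $k\ge1$ consider the weighted $k$-th moment of the projected ensemble and the generalized Scrooge moment $$\tilde\rho^{(k)}_{\mathrm{Proj.}}(t)=\sum_{x_B}\frac{|\tilde\Psi(x_B,t)\rangle\langle\tilde\Psi(x_B,t)|^{\otimes k}}{p_d(x_B)^{k-1}},\qquad \tilde\rho^{(k)}_{\mathrm{gen}}=\sum_{x_B}p_d(x_B)\,\tilde\rho^{(k)}_{\tilde{\mathrm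 S}\mathrm{cr.}}[\bar\rho(x_B)].$$ Assume that $H$ satisfies the $2k$-th no-resonance condition modulo degeneracies: whenever two lists of $2k$ eigenvalues of $H$ have equal sums, they are permutations of each other (this holds in particular if $H$ satisfies all no-resonance conditions). Then, at typical late times $t$, $\tilde\rho^{(k)}_{\mathrm{Proj.}}(t)=\tilde\rho^{(k)}_{\mathrm{gen}}+O(\Delta_\beta^{1/2})$. Precisely: there is a constant $C_k$ depending only on $k$ such that for every $\delta>0$ and all sufficiently large $T$, the following holds. 1. For all $t\in[0,T]$ outside a set of measure at most $\delta T$, in trace norm, $$\big\|\tilde\rho^{(k)}_{\mathrm{Proj.}}(t)-\tilde\rho^{(k)}_{\mathrm{gen}}\big\|_*\le C_k\,D_A^{2k}\,(\Delta_\beta/\delta)^{1/2}.$$ 2. For every operator $O$ on $\mathcal H_A^{\otimes k}$ (with "sufficiently large" and the exceptional set allowed to depend on $O$), for all $t\in[0,T]$ outside a set of measure at most $\delta T$, $$\big|\mathrm{tr}\big[O\,\big(\tilde\rho^{(k)}_{\mathrm{Proj.}}(t)-\tilde\rho^{(k)}_{\mathrm{gen}}\big)\big]\big|\le C_k\,\|O\|_{\mathrm{op}}\,(\Delta_\beta/\delta)^{1/2}.$$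 -/

import Mathlib

open MeasureTheory Filter Matrix
open scoped Kronecker ComplexConjugate ComplexOrder

namespace ProjectedEnsemble

noncomputable section

/-! ### Spectral data of a Hamiltonian -/

section Spectral

variable {n : Type*} [Fintype n] [DecidableEq n] {H : Matrix n n ℂ}

/-- The set of energies (distinct eigenvalues) of `H`. -/
def energies (hH : H.IsHermitian) : Finset ℝ :=
  Finset.univ.image hH.eigenvalues

/-- The `m`-th no-resonance condition, modulo degeneracies: two lists of `m` energies have the same
sum only if they are permutations of each other. If `H` has simple spectrum, equality of the
energies is equality of their labels. -/
def NoResonance (hH : H.IsHermitian) (m : ℕ) : Prop :=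
  ∀ α β : Fin m → n,
    ∑ j, hH.eigenvalues (α j) = ∑ j, hH.eigenvalues (β j) →
      ∃ σ : Equiv.Perm (Fin m), ∀ j, hH.eigenvalues (β j) = hH.eigenvalues (α (σ j))

/-- The component `c_E |E⟩` of `ψ` of energy `E`: the orthogonal projection of `ψ` to the
eigenspace of `H` for the eigenvalue `E`. -/
def energyComponent (hH : H.IsHermitian) (ψ : EuclideanSpace ℂ n) (E : ℝ) : n → ℂ :=
  fun a => ∑ i with hH.eigenvalues i = E,
    inner ℂ (hH.eigenvectorBasis i) ψ * hH.eigenvectorBasis i a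

/-- The rank-one operator `|v⟩⟨v|`. -/
def ketbra {ι : Type*} (v : ι → ℂ) : Matrix ι ι ℂ :=
  vecMulVec v (star v)

/-- The diagonal ensemble `ρ_d = ∑_E |c_E|² |E⟩⟨E|`. -/
def diagonalEnsemble (hH : H.IsHermitian) (ψ : EuclideanSpace ℂ n) : Matrix n n ℂ :=
  ∑ E ∈ energies hH, ketbra (energyComponent hH ψ E)

/-- The operator `ρ_d^{(2)} = ∑_E |c_E|⁴ |E,E⟩⟨E,E|`. -/
def diagonalEnsemble₂ (hH : H.IsHermitian) (ψ : EuclideanSpace ℂ n) :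
    Matrix (n × n) (n × n) ℂ :=
  ∑ E ∈ energies hH, ketbra (energyComponent hH ψ E) ⊗ₖ ketbra (energyComponent hH ψ E)

/-- The time-evolved state `exp(-i H t) ψ`. -/
def evolve (H : Matrix n n ℂ) (ψ : EuclideanSpace ℂ n) (t : ℝ) : n → ℂ :=
  NormedSpace.exp ((-Complex.I * (t : ℂ)) • H) *ᵥ ψ.ofLp

end Spectral

/-! ### Moments and the trace norm -/

/-- The operator `(|v⟩⟨v|)^{⊗k}` on `k` copies of the space. -/
def ketbraPow {A : Type*} (k : ℕ) (v : A → ℂ) : Matrix (Fin k → A) (Fin k → A) ℂ :=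
  fun a b => ∏ i, v (a i) * conj (v (b i))

/-- The trace norm: the sum of the singular values. -/
def traceNorm {ι : Type*} [Fintype ι] [DecidableEq ι] (M : Matrix ι ι ℂ) : ℝ :=
  ∑ i, √((isHermitian_conjTranspose_mul_self M).eigenvalues i)

/-- The operator norm, for the Euclidean norm on `ι → ℂ`. -/
def operatorNorm {ι : Type*} [Fintype ι] [DecidableEq ι] (M : Matrix ι ι ℂ) : ℝ :=
  ‖Matrix.toEuclideanCLM (n := ι) (𝕜 := ℂ) M‖

/-! ### The unnormalized Scrooge ensemble -/

/-- The centred complex Gaussian distribution of variance `v ≥ 0`, with density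
`(π v)⁻¹ exp(-|z|² / v)` if `v > 0`; it is the point mass at `0` if `v = 0`. -/
def complexGaussian (v : ℝ) : Measure ℂ :=
  if v = 0 then Measure.dirac 0
  else volume.withDensity fun z => ENNReal.ofReal ((v * Real.pi)⁻¹ * Real.exp (-v⁻¹ * ‖z‖ ^ 2))

section Scrooge

variable {A : Type*} [Fintype A] [DecidableEq A]

/-- The unnormalized Scrooge ensemble of `ρ`: the law of `∑ₘ gₘ |m⟩`, where `(λₘ, |m⟩)` is an
eigensystem of `ρ` and the `gₘ` are independent complex Gaussians of variance `λₘ`. -/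
def scrooge (ρ : Matrix A A ℂ) (hρ : ρ.PosSemidef) : Measure (A → ℂ) :=
  (Measure.pi fun m => complexGaussian (hρ.isHermitian.eigenvalues m)).map
    fun g => (hρ.isHermitian.eigenvectorUnitary : Matrix A A ℂ) *ᵥ g

/-- The `k`-th moment `∫ (|ψ⟩⟨ψ|)^{⊗k}` of the unnormalized Scrooge ensemble of `ρ`. -/
def scroogeMoment (k : ℕ) (ρ : Matrix A A ℂ) (hρ : ρ.PosSemidef) :
    Matrix (Fin k → A) (Fin k → A) ℂ :=
  fun a b => ∫ ψ, ketbraPow k ψ a b ∂(scrooge ρ hρ)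

end Scrooge

/-! ### Projection of a bipartite system -/

section Bipartite

variable {A B X : Type*} [Fintype A] [DecidableEq A] [Fintype B] [DecidableEq B] [Fintype X]
  {H : Matrix (A × B) (A × B) ℂ}

/-- The unnormalized projected state `(1 ⊗ ⟨x|) Ψ`. -/
def projectState (x : EuclideanSpace ℂ B) (Ψ : A × B → ℂ) : A → ℂ :=
  fun a => ∑ b, conj (x b) * Ψ (a, b)

/-- The operator `(1 ⊗ ⟨x|) M (1 ⊗ |x⟩)`. -/
def projectOperator (x : EuclideanSpace ℂ B) (M : Matrix (A × B) (A × B) ℂ) : Matrix A A ℂ :=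
  fun a a' => ∑ b, ∑ b', conj (x b) * M (a, b) (a', b') * x b'

/-- The time-averaged probability `p_d(x)` of the outcome `x`. -/
def pd (hH : H.IsHermitian) (Ψ₀ : EuclideanSpace ℂ (A × B)) (x : EuclideanSpace ℂ B) : ℝ :=
  (projectOperator x (diagonalEnsemble hH Ψ₀)).trace.re

/-- The average projected state `ρ̄(x)`. (It is `0` for an outcome with `p_d(x) = 0`, which never
occurs and contributes `0` everywhere below.) -/
def rhoBar (hH : H.IsHermitian) (Ψ₀ : EuclideanSpace ℂ (A × B)) (x : EuclideanSpace ℂ B) :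
    Matrix A A ℂ :=
  (pd hH Ψ₀ x)⁻¹ • projectOperator x (diagonalEnsemble hH Ψ₀)

lemma posSemidef_diagonalEnsemble (hH : H.IsHermitian) (Ψ₀ : EuclideanSpace ℂ (A × B)) :
    (diagonalEnsemble hH Ψ₀).PosSemidef :=
  posSemidef_sum _ fun _ _ => posSemidef_vecMulVec_self_star _

lemma posSemidef_projectOperator (x : EuclideanSpace ℂ B) {M : Matrix (A × B) (A × B) ℂ}
    (hM : M.PosSemidef) : (projectOperator x M).PosSemidef := by
  have h : projectOperator x M =
      (Matrix.of fun (p : A × B) (a : A) => if p.1 = a then x p.2 else 0)ᴴ * M *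
        (Matrix.of fun (p : A × B) (a : A) => if p.1 = a then x p.2 else 0) := by
    ext a a'
    simp only [projectOperator, Matrix.mul_apply, Fintype.sum_prod_type, conjTranspose_apply,
      Matrix.of_apply, Finset.sum_mul]
    rw [Finset.sum_eq_single a' (by
      intro c _ hc
      simp [hc]) (by simp)]
    simp only [if_true]
    rw [Finset.sum_comm]
    refine Finset.sum_congr rfl fun b' _ => ?_
    rw [Finset.sum_eq_single a (by
      intro c _ hc
      simp [hc]) (by simp)]
    simp
  rw [h]
  exact hM.conjTranspose_mul_mul_same _

lemma posSemidef_rhoBar (hH : H.IsHermitian) (Ψ₀ : EuclideanSpace ℂ (A × B))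
    (x : EuclideanSpace ℂ B) : (rhoBar hH Ψ₀ x).PosSemidef := by
  have h := posSemidef_projectOperator x (posSemidef_diagonalEnsemble hH Ψ₀)
  have h0 : 0 ≤ pd hH Ψ₀ x := (Complex.le_def.1 h.trace_nonneg).1
  exact h.smul (inv_nonneg.2 h0)

/-- `Δ_β(x) = tr[(1 ⊗ |x⟩⟨x|)^{⊗2} ρ_d^{(2)}] / p_d(x)²`. -/
def deltaOutcome (hH : H.IsHermitian) (Ψ₀ : EuclideanSpace ℂ (A × B))
    (x : EuclideanSpace ℂ B) : ℝ :=
  ((((1 : Matrix A A ℂ) ⊗ₖ ketbra x.ofLp) ⊗ₖ ((1 : Matrix A A ℂ) ⊗ₖ ketbra x.ofLp)) *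
    diagonalEnsemble₂ hH Ψ₀).trace.re / pd hH Ψ₀ x ^ 2

/-- `Δ_β = ∑_x p_d(x) Δ_β(x)`. -/
def deltaBeta (hH : H.IsHermitian) (Ψ₀ : EuclideanSpace ℂ (A × B))
    (x : OrthonormalBasis X ℂ (EuclideanSpace ℂ B)) : ℝ :=
  ∑ j, pd hH Ψ₀ (x j) * deltaOutcome hH Ψ₀ (x j)

/-- The weighted `k`-th moment of the projected ensemble at time `t`, for the measurement
basis `x` of the second factor: `∑_x |Ψ̃(x,t)⟩⟨Ψ̃(x,t)|^{⊗k} / p_d(x)^{k-1}`. -/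
def projectedMoment (k : ℕ) (hH : H.IsHermitian) (Ψ₀ : EuclideanSpace ℂ (A × B))
    (x : OrthonormalBasis X ℂ (EuclideanSpace ℂ B)) (t : ℝ) :
    Matrix (Fin k → A) (Fin k → A) ℂ :=
  ∑ j, (pd hH Ψ₀ (x j) ^ (k - 1))⁻¹ • ketbraPow k (projectState (x j) (evolve H Ψ₀ t))

/-- The `k`-th moment of the generalized (unnormalized) Scrooge ensemble. -/
def generalizedScroogeMoment (k : ℕ) (hH : H.IsHermitian) (Ψ₀ : EuclideanSpace ℂ (A × B))
    (x : OrthonormalBasis X ℂ (EuclideanSpace ℂ B)) :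
    Matrix (Fin k → A) (Fin k → A) ℂ :=
  ∑ j, pd hH Ψ₀ (x j) •
    scroogeMoment k (rhoBar hH Ψ₀ (x j)) (posSemidef_rhoBar hH Ψ₀ (x j))

end Bipartite

/-- `P t` holds for all times `t ≥ 0` but a fraction at most `δ`: for all large `T`, the times in
`[0, T]` at which `P` fails have measure at most `δ T`. -/
def HoldsExceptFraction (δ : ℝ) (P : ℝ → Prop) : Prop :=
  ∀ᶠ T : ℝ in atTop, volume.real {t | t ∈ Set.Icc 0 T ∧ ¬ P t} ≤ δ * T

end

end ProjectedEnsemble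

open ProjectedEnsemble

/-! Write `p x` for the averaged probability of the outcome `x` and `u x e` for the projected
component of energy `e` divided by `√(p x)`. Tested against `O`, the projected moment is the
`p`-average of `⟨Ψ^{⊗k}| O |Ψ^{⊗k}⟩` with `Ψ = ∑ₑ exp(-iet) u x e`. It is therefore a quasi-periodic
function `f(t)`: a sum over pairs of energy words `α`, `β` of length `k`, with coefficient
`meanForm` and frequency `∑ α - ∑ β` (`trace_mul_projectedMoment`). By Wick's formula
(`scroogeMoment_apply`), the Scrooge moment gives the sum `G = wickSum` of the coefficients over `β
= α ∘ σ`, each permutation `σ` counted separately (`trace_mul_generalizedScroogeMoment`). It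
suffices that the long-time mean of `|f - G|²` is `O(‖O‖² Δ_β)`, with no factor of the dimension.
Markov's inequality (`holdsExceptFraction_of_tendsto`) then gives the statement for a single
observable, and testing with matrix units gives the trace norm.

By the no-resonance condition, the time averages of `f` and of `|f|²` keep exactly the pairs of
words that are rearrangements of each other (`tendsto_average_phaseSum`). Two discrepancies from the
Gaussian value remain.

Repeated letters: summing over rearrangements and summing over permutations agree on words with
distinct letters. The other words are controlled by a union bound over coinciding slots, which
produces `∑ₓ p(x) ∑ₑ ‖u x e‖⁴`, and this is `Δ_β` (`norm_rearrangementSum_sub_le_of_bound`,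
`deltaBeta_eq`).

Cross pairings: in `|f|²` the permutations of the `2k` slots preserving the two copies of `f` add up
to `|G|²`; those mixing the copies must be small (`norm_sum_pairForm_le`). The sum for one pairing
is rewritten as an average over independent random sign vectors, one for each pair of slots, and the
two copies are separated by the arithmetic-geometric mean inequality. Each copy then has an input
and an output whose signs occur nowhere else in it. Averaging over these leaves the sum of the
squared entries `⟨v f, M v e⟩` of a block-diagonal form on the vectors `v e = ⨁ₓ √(p x) u x e`.
These are orthogonal because the energy components are, so Bessel's inequality bounds the sum by a
multiple of `purity`, which is at most `Δ_β` by convexity. -/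

namespace ProjectedEnsemble

/-! ### Sesquilinear forms on tensor powers -/

section TensorForm

variable {A : Type*} [Fintype A]

/-- The squared Euclidean norm of a vector. -/
noncomputable def sqNorm (v : A → ℂ) : ℝ :=
  ∑ a, ‖v a‖ ^ 2

lemma sqNorm_nonneg (v : A → ℂ) : 0 ≤ sqNorm v :=
  Finset.sum_nonneg fun _ _ => sq_nonneg _

lemma norm_toLp_sq (v : A → ℂ) : ‖WithLp.toLp 2 v‖ ^ 2 = sqNorm v := by
  rw [EuclideanSpace.norm_sq_eq]; rfl

lemma star_dotProduct_self (v : A → ℂ) : star v ⬝ᵥ v = (sqNorm v : ℂ) := by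
  simp only [dotProduct, sqNorm, Pi.star_apply, Complex.ofReal_sum]
  refine Finset.sum_congr rfl fun a _ => ?_
  rw [RCLike.star_def, Complex.conj_mul']
  push_cast; rfl

lemma sqNorm_tensor {κ : Type*} [Fintype κ] [DecidableEq κ] (ξ : κ → A → ℂ) :
    sqNorm (fun a : κ → A => ∏ i, ξ i (a i)) = ∏ i, sqNorm (ξ i) := by
  simp only [sqNorm, Finset.prod_univ_sum, Fintype.piFinset_univ, norm_prod, Finset.prod_pow]

lemma norm_dotProduct_mulVec_sq_le [DecidableEq A] (O : Matrix A A ℂ) (v w : A → ℂ) :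
    ‖star w ⬝ᵥ O *ᵥ v‖ ^ 2 ≤ operatorNorm O ^ 2 * (sqNorm v * sqNorm w) := by
  have h : star w ⬝ᵥ O *ᵥ v =
      inner ℂ (WithLp.toLp 2 w) (Matrix.toEuclideanCLM (n := A) (𝕜 := ℂ) O (WithLp.toLp 2 v)) := by
    rw [EuclideanSpace.inner_eq_star_dotProduct, dotProduct_comm]
    rfl
  rw [h, ← norm_toLp_sq, ← norm_toLp_sq, ← mul_pow, ← mul_pow]
  refine pow_le_pow_left₀ (norm_nonneg _) ?_ 2
  refine (norm_inner_le_norm _ _).trans ?_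
  have := (Matrix.toEuclideanCLM (n := A) (𝕜 := ℂ) O).le_opNorm (WithLp.toLp 2 v)
  have h2 := mul_le_mul_of_nonneg_left this (norm_nonneg (WithLp.toLp 2 w))
  refine h2.trans (le_of_eq ?_)
  unfold operatorNorm
  ring

variable {κ : Type*} [Fintype κ] [DecidableEq κ]

/-- The form `⟨⨂ ζᵢ| O |⨂ ξᵢ⟩`. -/
noncomputable def tensorForm (O : Matrix (κ → A) (κ → A) ℂ) (ξ ζ : κ → A → ℂ) : ℂ :=
  ∑ b, ∑ a, O b a * (∏ i, ξ i (a i)) * conj (∏ i, ζ i (b i))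

variable (O : Matrix (κ → A) (κ → A) ℂ)

lemma tensorForm_eq_dotProduct (ξ ζ : κ → A → ℂ) :
    tensorForm O ξ ζ =
      star (fun b : κ → A => ∏ i, ζ i (b i)) ⬝ᵥ O *ᵥ (fun a : κ → A => ∏ i, ξ i (a i)) := by
  simp only [tensorForm, dotProduct, mulVec, Finset.mul_sum, Pi.star_apply]
  refine Finset.sum_congr rfl fun b _ => Finset.sum_congr rfl fun a _ => ?_
  rw [RCLike.star_def]; ring

lemma norm_tensorForm_sq_le [DecidableEq A] (ξ ζ : κ → A → ℂ) :
    ‖tensorForm O ξ ζ‖ ^ 2 ≤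
      operatorNorm O ^ 2 * ((∏ i, sqNorm (ξ i)) * ∏ i, sqNorm (ζ i)) := by
  rw [tensorForm_eq_dotProduct, ← sqNorm_tensor, ← sqNorm_tensor]
  exact norm_dotProduct_mulVec_sq_le _ _ _

lemma operatorNorm_nonneg {n : Type*} [Fintype n] [DecidableEq n] (O : Matrix n n ℂ) :
    0 ≤ operatorNorm O := norm_nonneg _

lemma norm_tensorForm_le [DecidableEq A] (ξ ζ : κ → A → ℂ) :
    ‖tensorForm O ξ ζ‖ ≤
      operatorNorm O * ((∏ i, √(sqNorm (ξ i))) * ∏ i, √(sqNorm (ζ i))) := by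
  have h0 : 0 ≤ operatorNorm O * ((∏ i, √(sqNorm (ξ i))) * ∏ i, √(sqNorm (ζ i))) :=
    mul_nonneg (operatorNorm_nonneg O) (mul_nonneg (Finset.prod_nonneg fun _ _ => Real.sqrt_nonneg _)
      (Finset.prod_nonneg fun _ _ => Real.sqrt_nonneg _))
  refine le_of_sq_le_sq ?_ h0
  refine (norm_tensorForm_sq_le O ξ ζ).trans (le_of_eq ?_)
  rw [mul_pow, mul_pow, ← Finset.prod_pow, ← Finset.prod_pow]
  simp only [Real.sq_sqrt (sqNorm_nonneg _)]

lemma sum_comm_four {R α β γ δ : Type*} [AddCommMonoid R] [Fintype α] [Fintype β] [Fintype γ]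
    [Fintype δ] (F : α → β → γ → δ → R) :
    ∑ a, ∑ b, ∑ c, ∑ d, F a b c d = ∑ c, ∑ d, ∑ a, ∑ b, F a b c d := by
  calc ∑ a, ∑ b, ∑ c, ∑ d, F a b c d = ∑ q : α × β, ∑ r : γ × δ, F q.1 q.2 r.1 r.2 := by
        simp only [Fintype.sum_prod_type]
    _ = ∑ r : γ × δ, ∑ q : α × β, F q.1 q.2 r.1 r.2 := Finset.sum_comm
    _ = _ := by simp only [Fintype.sum_prod_type]

lemma tensorForm_sum {ι : Type*} [Fintype ι] (z y : κ → ι → ℂ) (w : ι → A → ℂ) :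
    tensorForm O (fun i a => ∑ e, z i e * w e a) (fun i a => ∑ e, y i e * w e a) =
      ∑ α : κ → ι, ∑ β : κ → ι, (∏ i, z i (α i)) * conj (∏ i, y i (β i)) *
        tensorForm O (fun i => w (α i)) (fun i => w (β i)) := by
  simp only [tensorForm, Finset.prod_univ_sum, Fintype.piFinset_univ, map_sum, Finset.mul_sum,
    Finset.sum_mul]
  rw [sum_comm_four, Finset.sum_comm]
  refine Finset.sum_congr rfl fun α _ => Finset.sum_congr rfl fun β _ =>
    Finset.sum_congr rfl fun b _ => Finset.sum_congr rfl fun a _ => ?_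
  simp only [Finset.prod_mul_distrib, map_mul]
  ring

omit [Fintype A] in
lemma prod_update_apply {R : Type*} [CommMonoid R] (ξ : κ → A → R) (i : κ) (v : A → R)
    (a : κ → A) :
    ∏ j, Function.update ξ i v j (a j) = v (a i) * ∏ j ∈ Finset.univ.erase i, ξ j (a j) := by
  rw [← Finset.mul_prod_erase Finset.univ _ (Finset.mem_univ i), Function.update_self]
  congr 1
  refine Finset.prod_congr rfl fun j hj => ?_
  rw [Function.update_of_ne (Finset.ne_of_mem_erase hj)]

/-- The operator on one tensor factor obtained by contracting all the slots of `tensorForm`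
but the input `i` and the output `j`. -/
noncomputable def slotMatrix [DecidableEq A] (ξ ζ : κ → A → ℂ) (i j : κ) : Matrix A A ℂ :=
  fun b a => tensorForm O (Function.update ξ i (Pi.single a 1)) (Function.update ζ j (Pi.single b 1))

lemma tensorForm_update [DecidableEq A] (ξ ζ : κ → A → ℂ) (i j : κ) (v w : A → ℂ) :
    tensorForm O (Function.update ξ i v) (Function.update ζ j w) =
      star w ⬝ᵥ slotMatrix O ξ ζ i j *ᵥ v := by
  have h1 : ∀ ζ', tensorForm O (Function.update ξ i v) ζ' =
      ∑ a, v a * tensorForm O (Function.update ξ i (Pi.single a 1)) ζ' := by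
    intro ζ'
    simp only [tensorForm, Finset.mul_sum, prod_update_apply]
    symm
    rw [Finset.sum_comm]
    refine Finset.sum_congr rfl fun b _ => ?_
    rw [Finset.sum_comm]
    refine Finset.sum_congr rfl fun a _ => ?_
    rw [Finset.sum_eq_single (a i)]
    · simp; ring
    · intro c _ hc
      simp [hc.symm]
    · simp
  have h2 : ∀ ξ', tensorForm O ξ' (Function.update ζ j w) =
      ∑ b, conj (w b) * tensorForm O ξ' (Function.update ζ j (Pi.single b 1)) := by
    intro ξ'
    simp only [tensorForm, Finset.mul_sum, prod_update_apply]
    symm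
    rw [Finset.sum_comm]
    refine Finset.sum_congr rfl fun b _ => ?_
    rw [Finset.sum_comm]
    refine Finset.sum_congr rfl fun a _ => ?_
    rw [Finset.sum_eq_single (b j)]
    · simp; ring
    · intro c _ hc
      simp [hc.symm]
    · simp
  rw [h2]
  simp only [h1, dotProduct, mulVec, Finset.mul_sum, slotMatrix, Pi.star_apply]
  refine Finset.sum_congr rfl fun b _ => Finset.sum_congr rfl fun a _ => ?_
  rw [RCLike.star_def]; ring

/-- By multilinearity the contracted matrix, evaluated on `v` and `w`, is again `O` between two
product vectors. The bound thus inherits `operatorNorm O` without any factor of the dimension. -/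
lemma norm_slotMatrix_sq_le [DecidableEq A] (ξ ζ : κ → A → ℂ) (i j : κ) (v w : A → ℂ) :
    ‖star w ⬝ᵥ slotMatrix O ξ ζ i j *ᵥ v‖ ^ 2 ≤
      (operatorNorm O ^ 2 * ((∏ l ∈ Finset.univ.erase i, sqNorm (ξ l)) *
        ∏ l ∈ Finset.univ.erase j, sqNorm (ζ l))) * (sqNorm v * sqNorm w) := by
  have key : ∀ (η : κ → A → ℂ) (m : κ) (y : A → ℂ), ∏ l, sqNorm (Function.update η m y l) =
      sqNorm y * ∏ l ∈ Finset.univ.erase m, sqNorm (η l) := by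
    intro η m y
    rw [← Finset.mul_prod_erase Finset.univ _ (Finset.mem_univ m), Function.update_self]
    congr 1
    refine Finset.prod_congr rfl fun l hl => ?_
    rw [Function.update_of_ne (Finset.ne_of_mem_erase hl)]
  rw [← tensorForm_update]
  refine (norm_tensorForm_sq_le O _ _).trans (le_of_eq ?_)
  rw [key, key]; ring

end TensorForm

/-! ### Bessel's inequality for block-diagonal forms -/

section Bessel

/-- Bessel's inequality for the normalized nonzero `v f`. The zero vectors drop out because division
by zero gives zero. -/
lemma sum_norm_inner_sq_div_le {ι E : Type*} [Fintype ι] [NormedAddCommGroup E]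
    [InnerProductSpace ℂ E] (v : ι → E) (hv : ∀ e f, e ≠ f → inner ℂ (v e) (v f) = 0) (y : E) :
    ∑ f, ‖inner ℂ (v f) y‖ ^ 2 / ‖v f‖ ^ 2 ≤ ‖y‖ ^ 2 := by
  classical
  let s : Type _ := {f : ι // v f ≠ 0}
  let w : s → E := fun f => ((‖v f‖⁻¹ : ℝ) : ℂ) • v f
  have hw : Orthonormal ℂ w := by
    constructor
    · intro f
      have : ‖v f‖ ≠ 0 := norm_ne_zero_iff.2 f.2
      simp [w, norm_smul, this]
    · intro e f hef
      simp only [w, inner_smul_left, inner_smul_right]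
      rw [hv _ _ (fun h => hef (Subtype.ext h))]
      simp
  have h := hw.sum_inner_products_le y (s := Finset.univ)
  refine le_trans (le_of_eq ?_) h
  rw [← Finset.sum_subset (Finset.filter_subset (fun f => v f ≠ 0) Finset.univ)]
  · rw [← Finset.sum_subtype_eq_sum_filter, Finset.subtype_univ]
    refine Finset.sum_congr rfl fun f _ => ?_
    simp only [w, inner_smul_left, norm_mul, Complex.conj_ofReal, Complex.norm_real, norm_inv,
      norm_norm]
    rw [mul_pow, inv_pow]; ring
  · intro f _ hf
    simp only [Finset.mem_filter, Finset.mem_univ, true_and, not_not] at hf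
    simp [hf]

variable {ι X A : Type*} [Fintype ι] [Fintype X] [Fintype A]

/-- In terms of `v e = ⨁ₓ √(p x) u x e` the left side sums `|⟨v f, M v e⟩|²` for a block-diagonal
`M`. Bessel's inequality asks for the weight `‖v e‖² / ‖v f‖²`. This weight and its inverse have
mean at least one, so it is enough to apply Bessel once to `M` and once to its adjoint and to
average the two bounds, which are equal. -/
lemma sum_norm_form_sq_le {p : X → ℝ} (hp : ∀ x, 0 ≤ p x) {u : X → ι → A → ℂ}
    (hu : ∀ e f, e ≠ f → ∑ x, (p x : ℂ) * (star (u x e) ⬝ᵥ u x f) = 0)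
    (M : X → Matrix A A ℂ) {N : X → ℝ}
    (hM : ∀ x v w, ‖star w ⬝ᵥ M x *ᵥ v‖ ^ 2 ≤ N x * (sqNorm v * sqNorm w)) :
    ∑ e, ∑ f, ‖∑ x, (p x : ℂ) * (star (u x f) ⬝ᵥ M x *ᵥ u x e)‖ ^ 2 ≤
      ∑ e, (∑ x, p x * sqNorm (u x e)) * ∑ x, p x * (N x * sqNorm (u x e)) := by
  obtain ⟨emb, hin, hnorm⟩ : ∃ emb : (X → A → ℂ) → EuclideanSpace ℂ (X × A),
      (∀ g h, inner ℂ (emb g) (emb h) = ∑ x, (p x : ℂ) * (star (g x) ⬝ᵥ h x)) ∧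
      ∀ g, ‖emb g‖ ^ 2 = ∑ x, p x * sqNorm (g x) := by
    refine ⟨fun g => WithLp.toLp 2 fun q => ((√(p q.1) : ℝ) : ℂ) * g q.1 q.2, ?_, ?_⟩
    · intro g h
      rw [EuclideanSpace.inner_eq_star_dotProduct, dotProduct_comm]
      simp only [dotProduct, Fintype.sum_prod_type, Finset.mul_sum, Pi.star_apply,
        RCLike.star_def, map_mul, Complex.conj_ofReal]
      refine Finset.sum_congr rfl fun x _ => Finset.sum_congr rfl fun a _ => ?_
      have : (p x : ℂ) = ((√(p x) : ℝ) : ℂ) * ((√(p x) : ℝ) : ℂ) := by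
        rw [← Complex.ofReal_mul, Real.mul_self_sqrt (hp x)]
      rw [this]; ring
    · intro g
      rw [norm_toLp_sq]
      simp only [sqNorm, Fintype.sum_prod_type, norm_mul, Complex.norm_real, mul_pow,
        Finset.mul_sum, Real.norm_eq_abs, sq_abs]
      refine Finset.sum_congr rfl fun x _ => Finset.sum_congr rfl fun a _ => ?_
      rw [Real.sq_sqrt (hp x)]
  let v : ι → EuclideanSpace ℂ (X × A) := fun e => emb fun x => u x e
  have hv : ∀ e f, e ≠ f → inner ℂ (v e) (v f) = 0 := fun e f hef => (hin _ _).trans (hu e f hef)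
  let Y : ι → EuclideanSpace ℂ (X × A) := fun e => emb fun x => M x *ᵥ u x e
  let Z : ι → EuclideanSpace ℂ (X × A) := fun f => emb fun x => (M x)ᴴ *ᵥ u x f
  -- The form bound is tested on `w = K v`. If `K v = 0` this says nothing, and since the sign of
  -- `n` is not given, `0 ≤ n * sqNorm v` comes from testing on `(v, v)`.
  have hself : ∀ (K : Matrix A A ℂ) (n : ℝ), (∀ v w, ‖star w ⬝ᵥ K *ᵥ v‖ ^ 2 ≤ n * (sqNorm v * sqNorm w)) →
      ∀ v, sqNorm (K *ᵥ v) ≤ n * sqNorm v := by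
    intro K n hK v
    have h := hK v (K *ᵥ v)
    rw [star_dotProduct_self, Complex.norm_real, Real.norm_eq_abs, sq_abs] at h
    rcases (sqNorm_nonneg (K *ᵥ v)).eq_or_lt with h0 | h0
    · rw [← h0]
      by_contra! hneg
      have h3 := hK v v
      have hvv : 0 < sqNorm v := by
        rcases (sqNorm_nonneg v).eq_or_lt with h1 | h1
        · rw [← h1] at hneg; simp at hneg
        · exact h1
      nlinarith [sq_nonneg ‖star v ⬝ᵥ K *ᵥ v‖]
    · have : sqNorm (K *ᵥ v) * sqNorm (K *ᵥ v) ≤ (n * sqNorm v) * sqNorm (K *ᵥ v) := by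
        nlinarith
      exact le_of_mul_le_mul_right this h0
  have hMH : ∀ x v w, star w ⬝ᵥ (M x)ᴴ *ᵥ v = star (star v ⬝ᵥ M x *ᵥ w) := by
    intro x v w
    rw [← Matrix.star_dotProduct_star, star_star, Matrix.star_mulVec,
      ← Matrix.dotProduct_mulVec]
  have hY : ∀ e, ‖Y e‖ ^ 2 ≤ ∑ x, p x * (N x * sqNorm (u x e)) := by
    intro e
    refine (hnorm _).trans_le ?_
    exact Finset.sum_le_sum fun x _ => mul_le_mul_of_nonneg_left (hself _ _ (hM x) _) (hp x)
  have hZ : ∀ e, ‖Z e‖ ^ 2 ≤ ∑ x, p x * (N x * sqNorm (u x e)) := by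
    intro e
    refine (hnorm _).trans_le ?_
    refine Finset.sum_le_sum fun x _ => mul_le_mul_of_nonneg_left (hself _ _ ?_ _) (hp x)
    intro v w
    rw [hMH, norm_star, mul_comm (sqNorm v)]
    exact hM x w v
  have hQ : ∀ e f, ∑ x, (p x : ℂ) * (star (u x f) ⬝ᵥ M x *ᵥ u x e) = inner ℂ (v f) (Y e) :=
    fun e f => (hin _ _).symm
  have hQ' : ∀ e f, ‖inner ℂ (v f) (Y e)‖ = ‖inner ℂ (v e) (Z f)‖ := by
    intro e f
    rw [← norm_star (inner ℂ (v e) (Z f)), show inner ℂ (v e) (Z f) = _ from hin _ _,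
      show inner ℂ (v f) (Y e) = _ from hin _ _, star_sum]
    congr 1
    refine Finset.sum_congr rfl fun x _ => ?_
    rw [star_mul', hMH, star_star]
    simp
  have hpt : ∀ e f, ‖inner ℂ (v f) (Y e)‖ ^ 2 ≤
      (1 / 2) * (‖v e‖ ^ 2 * (‖inner ℂ (v f) (Y e)‖ ^ 2 / ‖v f‖ ^ 2) +
        ‖v f‖ ^ 2 * (‖inner ℂ (v e) (Z f)‖ ^ 2 / ‖v e‖ ^ 2)) := by
    intro e f
    rw [← hQ']
    by_cases hf : v f = 0
    · simp [hf]
    by_cases he : v e = 0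
    · rw [hQ']; simp [he]
    have h1 : 0 < ‖v f‖ ^ 2 := by positivity
    have h2 : 0 < ‖v e‖ ^ 2 := by positivity
    generalize ‖v f‖ ^ 2 = r at *
    generalize ‖v e‖ ^ 2 = s at *
    have h3 : 0 ≤ ‖inner ℂ (v f) (Y e)‖ ^ 2 := sq_nonneg _
    generalize ‖inner ℂ (v f) (Y e)‖ ^ 2 = q at *
    rw [show (1 / 2 : ℝ) * (s * (q / r) + r * (q / s)) = q * ((s ^ 2 + r ^ 2) / (2 * (r * s))) by
      field_simp]
    refine le_mul_of_one_le_right h3 ?_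
    rw [one_le_div (by positivity)]
    nlinarith [sq_nonneg (s - r)]
  simp only [hQ]
  calc ∑ e, ∑ f, ‖inner ℂ (v f) (Y e)‖ ^ 2
      ≤ ∑ e, ∑ f, (1 / 2) * (‖v e‖ ^ 2 * (‖inner ℂ (v f) (Y e)‖ ^ 2 / ‖v f‖ ^ 2) +
        ‖v f‖ ^ 2 * (‖inner ℂ (v e) (Z f)‖ ^ 2 / ‖v e‖ ^ 2)) :=
        Finset.sum_le_sum fun e _ => Finset.sum_le_sum fun f _ => hpt e f
    _ = (1 / 2) * (∑ e, ‖v e‖ ^ 2 * ∑ f, ‖inner ℂ (v f) (Y e)‖ ^ 2 / ‖v f‖ ^ 2) +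
        (1 / 2) * (∑ f, ‖v f‖ ^ 2 * ∑ e, ‖inner ℂ (v e) (Z f)‖ ^ 2 / ‖v e‖ ^ 2) := by
        simp only [mul_add, Finset.sum_add_distrib, Finset.mul_sum]
        congr 1
        exact Finset.sum_comm
    _ ≤ (1 / 2) * (∑ e, ‖v e‖ ^ 2 * ∑ x, p x * (N x * sqNorm (u x e))) +
        (1 / 2) * (∑ f, ‖v f‖ ^ 2 * ∑ x, p x * (N x * sqNorm (u x f))) := by
        gcongr with e _ f _
        · exact (sum_norm_inner_sq_div_le v hv _).trans (hY e)
        · exact (sum_norm_inner_sq_div_le v hv _).trans (hZ f)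
    _ = _ := by
        rw [← mul_add, ← two_mul, ← mul_assoc]
        norm_num
        simp only [v, hnorm]

end Bessel

/-! ### Sums over pairs of words that are permutations of each other -/

section Rearrangement

variable {S ι : Type*} [Fintype S] [DecidableEq S] [Fintype ι] [DecidableEq ι]

open Classical in
/-- The sum of `c α β` over the pairs of words `α`, `β` that are rearrangements of each other. -/
noncomputable def rearrangementSum (c : (S → ι) → (S → ι) → ℂ) : ℂ :=
  ∑ α, ∑ β, if ∃ π : Equiv.Perm S, β = α ∘ π then c α β else 0

open Classical in
-- If `α` is injective, distinct `π` give distinct words `α ∘ π`, so there is no error. Otherwise a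
-- rearrangement is counted `m ≥ 1` times instead of once, and the excess `m - 1` is at most `m`.
lemma norm_rearrangementSum_sub_le (c : (S → ι) → (S → ι) → ℂ) :
    ‖rearrangementSum c - ∑ π : Equiv.Perm S, ∑ α, c α (α ∘ π)‖ ≤
      ∑ π : Equiv.Perm S, ∑ α with ¬ Function.Injective α, ‖c α (α ∘ π)‖ := by
  rw [Finset.sum_comm, rearrangementSum, ← Finset.sum_sub_distrib]
  rw [Finset.sum_comm (s := Finset.univ) (t := Finset.univ.filter _), Finset.sum_filter]
  refine (norm_sum_le _ _).trans (Finset.sum_le_sum fun α _ => ?_)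
  set im : Finset (S → ι) := Finset.univ.image fun π : Equiv.Perm S => α ∘ π with him
  have h1 : (∑ β, if ∃ π : Equiv.Perm S, β = α ∘ π then c α β else 0) = ∑ β ∈ im, c α β := by
    rw [← Finset.sum_filter]
    refine Finset.sum_congr ?_ fun _ _ => rfl
    ext β
    simp [him, eq_comm]
  rw [h1]
  split_ifs with hα
  rotate_left
  · have h2 : ∀ β ∈ im, 1 ≤ (Finset.univ.filter fun π : Equiv.Perm S => α ∘ π = β).card := by
      intro β hβ
      obtain ⟨π, -, hπ⟩ := Finset.mem_image.1 hβ
      exact Finset.card_pos.2 ⟨π, by simpa using hπ⟩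
    rw [Finset.sum_comp (fun β => c α β) (fun π : Equiv.Perm S => α ∘ π),
      Finset.sum_comp (fun β => ‖c α β‖) (fun π : Equiv.Perm S => α ∘ π), ← him,
      ← Finset.sum_sub_distrib]
    refine (norm_sum_le _ _).trans (Finset.sum_le_sum fun β hβ => ?_)
    have h3 := h2 β hβ
    generalize (Finset.univ.filter fun π : Equiv.Perm S => α ∘ π = β).card = m at *
    obtain ⟨m, rfl⟩ := Nat.exists_eq_add_of_le' h3
    rw [add_smul, one_smul, sub_add_cancel_right, norm_neg, add_smul, one_smul]
    refine (norm_nsmul_le).trans ?_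
    simp
  · rw [him, Finset.sum_image, sub_self, norm_zero]
    intro π _ σ _ h
    ext s
    exact hα (congrFun h s)

open Classical in
-- Union bound over the pairs of slots `s ≠ t` carrying the same letter: these two slots contribute
-- their overlap, at most `D`, and every other slot at most one.
lemma sum_not_injective_le {h : S → ι → ℝ} (h0 : ∀ s e, 0 ≤ h s e) (h1 : ∀ s, ∑ e, h s e ≤ 1)
    {D : ℝ} (hD : ∀ s t, ∑ e, h s e * h t e ≤ D) :
    ∑ α : S → ι with ¬ Function.Injective α, ∏ s, h s (α s) ≤ (Fintype.card S : ℝ) ^ 2 * D := by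
  have hpos : ∀ α : S → ι, 0 ≤ ∏ s, h s (α s) := fun α => Finset.prod_nonneg fun s _ => h0 s _
  have pair : ∀ s t : S, s ≠ t →
      ∑ α : S → ι, (if α s = α t then ∏ r, h r (α r) else 0) ≤ D := by
    intro s t hst
    -- The constraint `α s = α t` couples two slots. Once the common letter `e` is fixed, it becomes
    -- one condition for each slot and the sum over `α` factors.
    have hsum : ∀ α : S → ι, (if α s = α t then ∏ r, h r (α r) else 0) =
        ∑ e, ∏ r, (if (r = s ∨ r = t) ∧ α r ≠ e then 0 else h r (α r)) := by
      intro α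
      split_ifs with hα
      · rw [Finset.sum_eq_single (α s)]
        · refine Finset.prod_congr rfl fun r _ => ?_
          rw [if_neg]
          rintro ⟨rfl | rfl, h2⟩
          · exact h2 rfl
          · exact h2 hα.symm
        · intro e _ he
          exact Finset.prod_eq_zero (Finset.mem_univ s) (by simp [he.symm])
        · simp
      · symm
        refine Finset.sum_eq_zero fun e _ => ?_
        by_cases hs : α s = e
        · exact Finset.prod_eq_zero (Finset.mem_univ t)
            (by rw [if_pos]; exact ⟨Or.inr rfl, fun ht => hα (hs.trans ht.symm)⟩)
        · exact Finset.prod_eq_zero (Finset.mem_univ s) (by simp [hs])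
    simp_rw [hsum]
    rw [Finset.sum_comm]
    refine le_trans (Finset.sum_le_sum fun e _ => ?_) (hD s t)
    rw [← Fintype.piFinset_univ, ← Finset.prod_univ_sum (fun _ => Finset.univ)
      (fun r f => if (r = s ∨ r = t) ∧ f ≠ e then 0 else h r f)]
    rw [← Finset.mul_prod_erase Finset.univ _ (Finset.mem_univ s),
      ← Finset.mul_prod_erase (Finset.univ.erase s) _ (Finset.mem_erase.2 ⟨hst.symm, Finset.mem_univ t⟩),
      ← mul_assoc]
    have e1 : ∑ f, (if (s = s ∨ s = t) ∧ f ≠ e then 0 else h s f) = h s e := by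
      rw [Finset.sum_eq_single e] <;> simp +contextual
    have e2 : ∑ f, (if (t = s ∨ t = t) ∧ f ≠ e then 0 else h t f) = h t e := by
      rw [Finset.sum_eq_single e] <;> simp +contextual
    rw [e1, e2]
    refine mul_le_of_le_one_right (mul_nonneg (h0 _ _) (h0 _ _)) ?_
    refine Finset.prod_le_one (fun r _ => Finset.sum_nonneg fun f _ => ?_) (fun r _ => ?_)
    · split_ifs; exacts [le_rfl, h0 _ _]
    · refine le_trans (Finset.sum_le_sum fun f _ => ?_) (h1 r)
      split_ifs; exacts [h0 _ _, le_rfl]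
  -- Needed only for the vanishing terms `s = t`; nonnegativity of `D` follows from the hypotheses
  -- only when there is a slot.
  have hD0 : S → 0 ≤ D := fun s =>
    (Finset.sum_nonneg fun e _ => mul_nonneg (h0 s e) (h0 s e)).trans (hD s s)
  calc ∑ α : S → ι with ¬ Function.Injective α, ∏ s, h s (α s)
      ≤ ∑ α : S → ι, ∑ s, ∑ t, if s ≠ t then (if α s = α t then ∏ r, h r (α r) else 0) else 0 := by
        rw [Finset.sum_filter]
        refine Finset.sum_le_sum fun α _ => ?_
        have hnn : ∀ s t, 0 ≤ if s ≠ t then (if α s = α t then ∏ r, h r (α r) else 0) else 0 := by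
          intro s t
          split_ifs
          exacts [hpos α, le_rfl, le_rfl]
        split_ifs with hα
        rotate_left
        · simp only [Function.Injective, not_forall] at hα
          obtain ⟨s, t, hst, hne⟩ := hα
          refine le_trans ?_ (Finset.single_le_sum
            (fun s _ => Finset.sum_nonneg fun t _ => hnn s t) (Finset.mem_univ s))
          refine le_trans ?_ (Finset.single_le_sum (fun t _ => hnn s t) (Finset.mem_univ t))
          rw [if_pos hne, if_pos hst]
        · exact Finset.sum_nonneg fun s _ => Finset.sum_nonneg fun t _ => hnn s t
    _ = ∑ s, ∑ t, ∑ α : S → ι,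
          if s ≠ t then (if α s = α t then ∏ r, h r (α r) else 0) else 0 := by
        rw [Finset.sum_comm]
        exact Finset.sum_congr rfl fun s _ => Finset.sum_comm
    _ ≤ ∑ s : S, ∑ t : S, D := by
        refine Finset.sum_le_sum fun s _ => Finset.sum_le_sum fun t _ => ?_
        by_cases hst : s = t
        · simpa [hst] using hD0 t
        · simpa [hst] using pair s t hst
    _ = (Fintype.card S : ℝ) ^ 2 * D := by
        simp [Finset.card_univ]; ring

lemma sqrt_mul_sqrt_le {a b : ℝ} (ha : 0 ≤ a) (hb : 0 ≤ b) : √a * √b ≤ (a + b) / 2 := by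
  nlinarith [sq_nonneg (√a - √b), Real.sq_sqrt ha, Real.sq_sqrt hb]

omit [DecidableEq ι] in
lemma sum_sqrt_mul_four_le {a b c d : ι → ℝ} (ha : ∀ e, 0 ≤ a e) (hb : ∀ e, 0 ≤ b e)
    (hc : ∀ e, 0 ≤ c e) (hd : ∀ e, 0 ≤ d e) {D : ℝ} (ha2 : ∑ e, a e ^ 2 ≤ D)
    (hb2 : ∑ e, b e ^ 2 ≤ D) (hc2 : ∑ e, c e ^ 2 ≤ D) (hd2 : ∑ e, d e ^ 2 ≤ D) :
    ∑ e, (√(a e) * √(b e)) * (√(c e) * √(d e)) ≤ D := by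
  calc ∑ e, (√(a e) * √(b e)) * (√(c e) * √(d e))
      ≤ ∑ e, (1 / 4) * (a e ^ 2 + b e ^ 2 + c e ^ 2 + d e ^ 2) := by
        refine Finset.sum_le_sum fun e _ => ?_
        have h1 := sqrt_mul_sqrt_le (ha e) (hb e)
        have h2 := sqrt_mul_sqrt_le (hc e) (hd e)
        refine (mul_le_mul h1 h2 (by positivity) (by linarith [ha e, hb e])).trans ?_
        nlinarith [sq_nonneg (a e - b e), sq_nonneg (c e - d e), sq_nonneg (a e - c e),
          sq_nonneg (a e - d e), sq_nonneg (b e - c e), sq_nonneg (b e - d e)]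
    _ = (1 / 4) * (∑ e, a e ^ 2 + ∑ e, b e ^ 2 + ∑ e, c e ^ 2 + ∑ e, d e ^ 2) := by
        rw [← Finset.mul_sum]; simp only [Finset.sum_add_distrib]
    _ ≤ D := by linarith

/-- For fixed `π`, moving the output weights to the input slots gives slot `s` the weight `√(y s)
√(z (π⁻¹ s))`. The arithmetic-geometric mean inequality bounds its total mass by one and the overlap
of any two such weights by `D`. -/
lemma norm_rearrangementSum_sub_le_of_bound {c : (S → ι) → (S → ι) → ℂ} {y z : S → ι → ℝ}
    {N D : ℝ} (hN : 0 ≤ N) (hy0 : ∀ s e, 0 ≤ y s e) (hz0 : ∀ s e, 0 ≤ z s e)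
    (hy1 : ∀ s, ∑ e, y s e ≤ 1) (hz1 : ∀ s, ∑ e, z s e ≤ 1)
    (hy2 : ∀ s, ∑ e, y s e ^ 2 ≤ D) (hz2 : ∀ s, ∑ e, z s e ^ 2 ≤ D)
    (hc : ∀ α β, ‖c α β‖ ≤ N * ((∏ s, √(y s (α s))) * ∏ s, √(z s (β s)))) :
    ‖rearrangementSum c - ∑ π : Equiv.Perm S, ∑ α, c α (α ∘ π)‖ ≤
      (Fintype.card S).factorial * (Fintype.card S : ℝ) ^ 2 * (N * D) := by
  classical
  refine (norm_rearrangementSum_sub_le c).trans ?_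
  have hπ : ∀ π : Equiv.Perm S, ∑ α with ¬ Function.Injective α, ‖c α (α ∘ π)‖ ≤
      (Fintype.card S : ℝ) ^ 2 * (N * D) := by
    intro π
    have hb := sum_not_injective_le (h := fun s e => √(y s e) * √(z (π.symm s) e))
      (fun s e => by positivity) (fun s => ?_) (D := D) (fun s t => ?_)
    · calc ∑ α with ¬ Function.Injective α, ‖c α (α ∘ π)‖
          ≤ ∑ α : S → ι with ¬ Function.Injective α,
              N * ∏ s, √(y s (α s)) * √(z (π.symm s) (α s)) := by
            refine Finset.sum_le_sum fun α _ => (hc _ _).trans (le_of_eq ?_)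
            rw [Finset.prod_mul_distrib]
            congr 2
            rw [← Equiv.prod_comp π fun s => √(z (π.symm s) (α s))]
            simp
        _ = N * ∑ α : S → ι with ¬ Function.Injective α,
              ∏ s, √(y s (α s)) * √(z (π.symm s) (α s)) := by rw [Finset.mul_sum]
        _ ≤ N * ((Fintype.card S : ℝ) ^ 2 * D) := mul_le_mul_of_nonneg_left hb hN
        _ = _ := by ring
    · calc ∑ e, √(y s e) * √(z (π.symm s) e) ≤ ∑ e, (y s e + z (π.symm s) e) / 2 :=
            Finset.sum_le_sum fun e _ => sqrt_mul_sqrt_le (hy0 _ _) (hz0 _ _)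
        _ = (∑ e, y s e + ∑ e, z (π.symm s) e) / 2 := by
            rw [← Finset.sum_div, Finset.sum_add_distrib]
        _ ≤ 1 := by linarith [hy1 s, hz1 (π.symm s)]
    · exact sum_sqrt_mul_four_le (hy0 _) (hz0 _) (hy0 _) (hz0 _) (hy2 _) (hz2 _) (hy2 _) (hz2 _)
  refine (Finset.sum_le_sum fun π _ => hπ π).trans (le_of_eq ?_)
  simp [Finset.card_univ, Fintype.card_perm]; ring

end Rearrangement

/-! ### Random signs -/

section Signs

variable {ι A : Type*} [Fintype ι] [DecidableEq ι] [Fintype A]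

/-- The probability of one choice of signs indexed by `ι`. -/
noncomputable def signWeight (ι : Type*) [Fintype ι] [DecidableEq ι] : ℝ :=
  (Fintype.card (ι → ℤˣ) : ℝ)⁻¹

lemma signWeight_pos : 0 < signWeight ι :=
  inv_pos.2 (Nat.cast_pos.2 Fintype.card_pos)

lemma sum_signWeight : ∑ _ω : ι → ℤˣ, signWeight ι = 1 := by
  rw [Finset.sum_const, Finset.card_univ, nsmul_eq_mul, signWeight, mul_inv_cancel₀]
  exact Nat.cast_ne_zero.2 Fintype.card_ne_zero

/-- The sign `ω e` as a complex number. -/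
def sgn (ω : ι → ℤˣ) (e : ι) : ℂ := ((ω e : ℤ) : ℂ)

omit [Fintype ι] [DecidableEq ι] in
lemma conj_sgn (ω : ι → ℤˣ) (e : ι) : conj (sgn ω e) = sgn ω e := by
  simp [sgn]

omit [Fintype ι] [DecidableEq ι] in
lemma sgn_mul_self (ω : ι → ℤˣ) (e : ι) : sgn ω e * sgn ω e = 1 := by
  rcases Int.units_eq_one_or (ω e) with h | h <;> simp [sgn, h]

omit [Fintype ι] [DecidableEq ι] in
lemma norm_sgn (ω : ι → ℤˣ) (e : ι) : ‖sgn ω e‖ = 1 := by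
  rcases Int.units_eq_one_or (ω e) with h | h <;> simp [sgn, h]

/-- The involution flipping the sign of index `e`. -/
def flipSign (e : ι) : (ι → ℤˣ) ≃ (ι → ℤˣ) where
  toFun ω := Function.update ω e (-ω e)
  invFun ω := Function.update ω e (-ω e)
  left_inv ω := by simp
  right_inv ω := by simp

omit [Fintype ι] in
lemma sgn_flipSign_self (ω : ι → ℤˣ) (e : ι) : sgn (flipSign e ω) e = -sgn ω e := by
  simp [sgn, flipSign]

omit [Fintype ι] in
lemma sgn_flipSign_of_ne (ω : ι → ℤˣ) {e f : ι} (h : f ≠ e) :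
    sgn (flipSign e ω) f = sgn ω f := by
  simp [sgn, flipSign, h]

lemma sum_sgn_mul_sgn (e f : ι) :
    ∑ ω : ι → ℤˣ, (signWeight ι : ℂ) * (sgn ω e * sgn ω f) = if e = f then 1 else 0 := by
  split_ifs with h
  · subst h
    simp only [sgn_mul_self, mul_one]
    exact_mod_cast sum_signWeight (ι := ι)
  · have h1 := Equiv.sum_comp (flipSign e)
      (fun ω : ι → ℤˣ => (signWeight ι : ℂ) * (sgn ω e * sgn ω f))
    simp only [sgn_flipSign_self, sgn_flipSign_of_ne _ (Ne.symm h), neg_mul, mul_neg,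
      Finset.sum_neg_distrib] at h1
    exact CharZero.eq_neg_self_iff.1 h1.symm

/-- The random vector `∑ₑ ωₑ uₑ`. -/
noncomputable def signSum (u : ι → A → ℂ) (ω : ι → ℤˣ) : A → ℂ :=
  fun a => ∑ e, sgn ω e * u e a

lemma sqNorm_add_add_sqNorm_sub (v w : A → ℂ) :
    sqNorm (v + w) + sqNorm (v - w) = 2 * (sqNorm v + sqNorm w) := by
  simp only [sqNorm, ← Finset.sum_add_distrib, Finset.mul_sum]
  refine Finset.sum_congr rfl fun a _ => ?_
  have := parallelogram_law_with_norm ℝ (v a) (w a)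
  simp only [Pi.add_apply, Pi.sub_apply]
  nlinarith

lemma abs_sqNorm_add_sub_le (v w : A → ℂ) :
    (sqNorm (v + w) - sqNorm (v - w)) ^ 2 ≤ 16 * (sqNorm v * sqNorm w) := by
  rw [← norm_toLp_sq, ← norm_toLp_sq, ← norm_toLp_sq, ← norm_toLp_sq, WithLp.toLp_add,
    WithLp.toLp_sub]
  generalize (WithLp.toLp 2 v : EuclideanSpace ℂ A) = x
  generalize (WithLp.toLp 2 w : EuclideanSpace ℂ A) = y
  rw [@norm_add_sq ℂ, @norm_sub_sq ℂ]
  have h := sq_le_sq' (by linarith [neg_abs_le (RCLike.re (inner ℂ x y)), RCLike.abs_re_le_norm (inner ℂ x y), norm_inner_le_norm (𝕜 := ℂ) x y])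
    ((RCLike.re_le_norm (inner ℂ x y)).trans (norm_inner_le_norm x y))
  nlinarith

omit [Fintype ι] [DecidableEq ι] in
lemma sqNorm_sgn_smul (ω : ι → ℤˣ) (e : ι) (v : A → ℂ) : sqNorm (sgn ω e • v) = sqNorm v := by
  simp [sqNorm, norm_sgn]

omit [Fintype ι] [Fintype A] in
lemma sum_flipSign (u : ι → A → ℂ) {s : Finset ι} {e : ι} (he : e ∉ s) (ω : ι → ℤˣ) :
    ∑ f ∈ insert e s, sgn (flipSign e ω) f • u f = ∑ f ∈ s, sgn ω f • u f - sgn ω e • u e := by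
  rw [Finset.sum_insert he, sgn_flipSign_self, neg_smul, neg_add_eq_sub]
  congr 1
  refine Finset.sum_congr rfl fun f hf => ?_
  have hfe : f ≠ e := by
    rintro rfl
    exact he hf
  rw [sgn_flipSign_of_ne _ hfe]

lemma sum_sqNorm_partial (u : ι → A → ℂ) (s : Finset ι) :
    ∑ ω : ι → ℤˣ, signWeight ι * sqNorm (∑ e ∈ s, sgn ω e • u e) = ∑ e ∈ s, sqNorm (u e) := by
  induction s using Finset.induction_on with
  | empty => simp [sqNorm]
  | insert e s he ih =>
    have h1 := Equiv.sum_comp (flipSign e)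
      (fun ω : ι → ℤˣ => signWeight ι * sqNorm (∑ f ∈ insert e s, sgn ω f • u f))
    simp only [sum_flipSign u he] at h1
    have h2 : ∑ ω : ι → ℤˣ, signWeight ι * sqNorm (∑ f ∈ s, sgn ω f • u f - sgn ω e • u e) +
        ∑ ω : ι → ℤˣ, signWeight ι * sqNorm (∑ f ∈ insert e s, sgn ω f • u f) =
        2 * (∑ e ∈ insert e s, sqNorm (u e)) := by
      rw [← Finset.sum_add_distrib, Finset.sum_insert he, ← ih]
      have : sqNorm (u e) = ∑ ω : ι → ℤˣ, signWeight ι * sqNorm (u e) := by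
        rw [← Finset.sum_mul, sum_signWeight, one_mul]
      rw [this, ← Finset.sum_add_distrib, Finset.mul_sum]
      refine Finset.sum_congr rfl fun ω _ => ?_
      have h3 := sqNorm_add_add_sqNorm_sub (∑ f ∈ s, sgn ω f • u f) (sgn ω e • u e)
      rw [sqNorm_sgn_smul] at h3
      rw [Finset.sum_insert he, add_comm (sgn ω e • u e)]
      linear_combination (signWeight ι) * h3
    linarith

/-- Add one vector `w` to a partial sum `v` and average over the sign of `w`. With `V = ‖v‖²` and `W
= ‖w‖²`, the parallelogram law and Cauchy–Schwarz give `‖v + w‖⁴ + ‖v - w‖⁴ ≤ 2 V² + 12 V W + 2 W²`.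
Hence the fourth moment grows by at most `6 W E[V] + W²`, less than the growth of three times the
squared second moment. -/
lemma sum_sqNorm_sq_partial_le (u : ι → A → ℂ) (s : Finset ι) :
    ∑ ω : ι → ℤˣ, signWeight ι * sqNorm (∑ e ∈ s, sgn ω e • u e) ^ 2 ≤
      3 * (∑ e ∈ s, sqNorm (u e)) ^ 2 := by
  induction s using Finset.induction_on with
  | empty => simp [sqNorm]
  | insert e s he ih =>
    have h1 := Equiv.sum_comp (flipSign e)
      (fun ω : ι → ℤˣ => signWeight ι * sqNorm (∑ f ∈ insert e s, sgn ω f • u f) ^ 2)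
    simp only [sum_flipSign u he] at h1
    have h2 : ∑ ω : ι → ℤˣ, signWeight ι * sqNorm (∑ f ∈ s, sgn ω f • u f - sgn ω e • u e) ^ 2 +
        ∑ ω : ι → ℤˣ, signWeight ι * sqNorm (∑ f ∈ insert e s, sgn ω f • u f) ^ 2 ≤
        ∑ ω : ι → ℤˣ, (2 * (signWeight ι * sqNorm (∑ f ∈ s, sgn ω f • u f) ^ 2) +
          12 * sqNorm (u e) * (signWeight ι * sqNorm (∑ f ∈ s, sgn ω f • u f)) +
          2 * sqNorm (u e) ^ 2 * signWeight ι) := by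
      rw [← Finset.sum_add_distrib]
      refine Finset.sum_le_sum fun ω _ => ?_
      have h3 := sqNorm_add_add_sqNorm_sub (∑ f ∈ s, sgn ω f • u f) (sgn ω e • u e)
      have h4 := abs_sqNorm_add_sub_le (∑ f ∈ s, sgn ω f • u f) (sgn ω e • u e)
      rw [sqNorm_sgn_smul] at h3 h4
      rw [Finset.sum_insert he, add_comm (sgn ω e • u e)]
      have h5 : sqNorm (∑ f ∈ s, sgn ω f • u f - sgn ω e • u e) ^ 2 +
          sqNorm (∑ f ∈ s, sgn ω f • u f + sgn ω e • u e) ^ 2 ≤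
          2 * sqNorm (∑ f ∈ s, sgn ω f • u f) ^ 2 +
          12 * sqNorm (u e) * sqNorm (∑ f ∈ s, sgn ω f • u f) + 2 * sqNorm (u e) ^ 2 := by
        have h6 := congrArg (fun r : ℝ => r ^ 2) h3
        nlinarith
      have := mul_le_mul_of_nonneg_left h5 (signWeight_pos (ι := ι)).le
      linarith
    rw [h1, Finset.sum_add_distrib, Finset.sum_add_distrib,
      ← Finset.mul_sum Finset.univ (fun ω : ι → ℤˣ => signWeight ι * _ ^ 2),
      ← Finset.mul_sum Finset.univ (fun ω : ι → ℤˣ => signWeight ι * _),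
      ← Finset.mul_sum Finset.univ (fun ω : ι → ℤˣ => signWeight ι), sum_sqNorm_partial,
      sum_signWeight] at h2
    have h6 : 0 ≤ ∑ f ∈ s, sqNorm (u f) := Finset.sum_nonneg fun _ _ => sqNorm_nonneg _
    rw [Finset.sum_insert he]
    nlinarith [sqNorm_nonneg (u e), sq_nonneg (sqNorm (u e))]

omit [DecidableEq ι] [Fintype A] in
lemma signSum_eq (u : ι → A → ℂ) (ω : ι → ℤˣ) : signSum u ω = ∑ e, sgn ω e • u e := by
  ext a
  simp [signSum, Finset.sum_apply]

lemma sum_sqNorm_signSum_sq_le (u : ι → A → ℂ) :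
    ∑ ω : ι → ℤˣ, signWeight ι * sqNorm (signSum u ω) ^ 2 ≤ 3 * (∑ e, sqNorm (u e)) ^ 2 := by
  simp only [signSum_eq]
  exact sum_sqNorm_sq_partial_le u Finset.univ

lemma sum_norm_sgn_sum_sq (c : ι → ℂ) :
    ∑ ω : ι → ℤˣ, signWeight ι * ‖∑ e, sgn ω e * c e‖ ^ 2 = ∑ e, ‖c e‖ ^ 2 := by
  have h := sum_sqNorm_partial (A := Unit) (fun e _ => c e) Finset.univ
  simpa [sqNorm, Finset.sum_apply] using h

/-- Parseval: the products `sgn ω e * sgn ω' f` of independent signs are orthonormal. -/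
lemma sum_norm_sgn_sum_sum_sq (Q : ι → ι → ℂ) :
    ∑ ω : ι → ℤˣ, signWeight ι * ∑ ω' : ι → ℤˣ, signWeight ι *
      ‖∑ e, ∑ f, sgn ω e * sgn ω' f * Q e f‖ ^ 2 = ∑ e, ∑ f, ‖Q e f‖ ^ 2 := by
  have h1 : ∀ ω ω' : ι → ℤˣ, ∑ e, ∑ f, sgn ω e * sgn ω' f * Q e f =
      ∑ f, sgn ω' f * ∑ e, sgn ω e * Q e f := by
    intro ω ω'
    rw [Finset.sum_comm]
    refine Finset.sum_congr rfl fun f _ => ?_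
    rw [Finset.mul_sum]
    exact Finset.sum_congr rfl fun e _ => by ring
  simp only [h1, sum_norm_sgn_sum_sq]
  simp only [Finset.mul_sum (s := Finset.univ (α := ι)) (a := signWeight ι)]
  rw [Finset.sum_comm]
  simp only [sum_norm_sgn_sum_sq]
  exact Finset.sum_comm

variable {S : Type*} [Fintype S] [DecidableEq S]

lemma sum_prod_signs {R : Type*} [CommSemiring R] (f : S → (ι → ℤˣ) → R) :
    ∑ ε : S → ι → ℤˣ, ∏ s, f s (ε s) = ∏ s, ∑ ω, f s ω := by
  rw [Finset.prod_univ_sum, Fintype.piFinset_univ]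

/-- Exchanging the coordinate `a` with a fresh value is an involution of the pairs `(ε, ω)`. -/
lemma sum_resample {Ω : Type*} [Fintype Ω] (g : (S → Ω) → ℝ) (a : S) :
    ∑ ε : S → Ω, ∑ ω, g (Function.update ε a ω) = Fintype.card Ω * ∑ ε, g ε := by
  have h : ∑ q : (S → Ω) × Ω, g (Function.update q.1 a q.2) = ∑ q : (S → Ω) × Ω, g q.1 := by
    refine Finset.sum_bij' (fun q _ => (Function.update q.1 a q.2, q.1 a))
      (fun q _ => (Function.update q.1 a q.2, q.1 a)) ?_ ?_ ?_ ?_ ?_ <;> simp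
  rw [Fintype.sum_prod_type, Fintype.sum_prod_type] at h
  rw [h]
  simp [Finset.mul_sum, Finset.card_univ]

lemma sum_resample_signs (g : (S → ι → ℤˣ) → ℝ) (a : S) :
    ∑ ε : S → ι → ℤˣ, ∑ ω, signWeight ι * g (Function.update ε a ω) = ∑ ε, g ε := by
  simp only [← Finset.mul_sum]
  rw [sum_resample, ← mul_assoc, signWeight, inv_mul_cancel₀, one_mul]
  exact Nat.cast_ne_zero.2 Fintype.card_ne_zero

end Signs

/-! ### Second moments of random-phase forms -/

section Variance

variable {ι X A κ : Type*} [Fintype ι] [DecidableEq ι] [Fintype X] [Fintype A] [DecidableEq A]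
  [Fintype κ] [DecidableEq κ]

lemma norm_rearrangementSum_sum_sub_le {S Y : Type*} [Fintype S] [DecidableEq S] [Fintype Y]
    {w : Y → ℝ} (hw : ∀ r, 0 ≤ w r) {c : Y → (S → ι) → (S → ι) → ℂ} {y z : Y → S → ι → ℝ}
    {N : ℝ} {D : Y → ℝ} (hN : 0 ≤ N) (hy0 : ∀ r s e, 0 ≤ y r s e) (hz0 : ∀ r s e, 0 ≤ z r s e)
    (hy1 : ∀ r s, ∑ e, y r s e ≤ 1) (hz1 : ∀ r s, ∑ e, z r s e ≤ 1)
    (hy2 : ∀ r s, ∑ e, y r s e ^ 2 ≤ D r) (hz2 : ∀ r s, ∑ e, z r s e ^ 2 ≤ D r)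
    (hc : ∀ r α β, ‖c r α β‖ ≤ N * ((∏ s, √(y r s (α s))) * ∏ s, √(z r s (β s)))) :
    ‖rearrangementSum (fun α β => ∑ r, (w r : ℂ) * c r α β) -
        ∑ π : Equiv.Perm S, ∑ α, ∑ r, (w r : ℂ) * c r α (α ∘ π)‖ ≤
      (Fintype.card S).factorial * (Fintype.card S : ℝ) ^ 2 * (N * ∑ r, w r * D r) := by
  classical
  have h1 : rearrangementSum (fun α β => ∑ r, (w r : ℂ) * c r α β) =
      ∑ r, (w r : ℂ) * rearrangementSum (c r) := by
    simp only [rearrangementSum, Finset.mul_sum, mul_ite, mul_zero]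
    rw [Finset.sum_comm]
    rw [Finset.sum_comm (s := (Finset.univ : Finset Y))]
    refine (Finset.sum_comm).trans (Finset.sum_congr rfl fun α _ => ?_)
    rw [Finset.sum_comm]
    refine Finset.sum_congr rfl fun β _ => ?_
    split_ifs
    · rfl
    · simp
  have h2 : ∑ π : Equiv.Perm S, ∑ α, ∑ r, (w r : ℂ) * c r α (α ∘ π) =
      ∑ r, (w r : ℂ) * ∑ π : Equiv.Perm S, ∑ α, c r α (α ∘ π) := by
    simp only [Finset.mul_sum]
    rw [Finset.sum_comm (s := (Finset.univ : Finset Y))]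
    exact Finset.sum_congr rfl fun π _ => Finset.sum_comm
  rw [h1, h2, ← Finset.sum_sub_distrib]
  refine (norm_sum_le _ _).trans ?_
  rw [Finset.mul_sum, Finset.mul_sum]
  refine Finset.sum_le_sum fun r _ => ?_
  rw [← mul_sub, norm_mul, Complex.norm_real, Real.norm_of_nonneg (hw r)]
  refine (mul_le_mul_of_nonneg_left (norm_rearrangementSum_sub_le_of_bound hN (hy0 r) (hz0 r)
    (hy1 r) (hz1 r) (hy2 r) (hz2 r) (hc r)) (hw r)).trans (le_of_eq ?_)
  ring

/-- A family of vectors `u x e`, weighted by probabilities `p x`, such that each `(u x e)ₑ` has total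
squared norm at most one, and such that the direct sums `⨁ₓ √(p x) u x e` are orthogonal. -/
structure IsOrthogonalFamily (p : X → ℝ) (u : X → ι → A → ℂ) : Prop where
  nonneg : ∀ x, 0 ≤ p x
  sum_weight : ∑ x, p x = 1
  sum_sqNorm_le : ∀ x, ∑ e, sqNorm (u x e) ≤ 1
  orthogonal : ∀ e f, e ≠ f → ∑ x, (p x : ℂ) * (star (u x e) ⬝ᵥ u x f) = 0

/-- The average fourth moment `∑ₓ p(x) ∑ₑ ‖u x e‖⁴`. -/
noncomputable def quarticSpread (p : X → ℝ) (u : X → ι → A → ℂ) : ℝ :=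
  ∑ x, p x * ∑ e, sqNorm (u x e) ^ 2

/-- The average over `x` of the matrix element of `O` between the products `⨂ u x (β i)` and
`⨂ u x (α i)`. -/
noncomputable def meanForm (O : Matrix (κ → A) (κ → A) ℂ) (p : X → ℝ) (u : X → ι → A → ℂ)
    (α β : κ → ι) : ℂ :=
  ∑ x, (p x : ℂ) * tensorForm O (fun i => u x (α i)) (fun i => u x (β i))

/-- The product of a matrix element and the conjugate of another one, as a function of the
energies that occur with negative and with positive frequencies. -/
noncomputable def pairForm (O : Matrix (κ → A) (κ → A) ℂ) (p : X → ℝ) (u : X → ι → A → ℂ)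
    (α β : κ ⊕ κ → ι) : ℂ :=
  meanForm O p u (α ∘ Sum.inl) (β ∘ Sum.inl) * conj (meanForm O p u (β ∘ Sum.inr) (α ∘ Sum.inr))

/-- The sum over all the pairings of the energies, i.e. the Gaussian average. -/
noncomputable def wickSum (O : Matrix (κ → A) (κ → A) ℂ) (p : X → ℝ) (u : X → ι → A → ℂ) : ℂ :=
  ∑ σ : Equiv.Perm κ, ∑ α, meanForm O p u α (α ∘ σ)

variable {p : X → ℝ} {u : X → ι → A → ℂ} (O : Matrix (κ → A) (κ → A) ℂ)

lemma norm_rearrangementSum_meanForm_sub_le (h : IsOrthogonalFamily p u) :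
    ‖rearrangementSum (meanForm O p u) - wickSum O p u‖ ≤
      (Fintype.card κ).factorial * (Fintype.card κ : ℝ) ^ 2 *
        (operatorNorm O * quarticSpread p u) :=
  norm_rearrangementSum_sum_sub_le (S := κ) (Y := X) h.nonneg
    (c := fun x α β => tensorForm O (fun i => u x (α i)) (fun i => u x (β i)))
    (y := fun x _ e => sqNorm (u x e)) (z := fun x _ e => sqNorm (u x e))
    (D := fun x => ∑ e, sqNorm (u x e) ^ 2)
    (operatorNorm_nonneg O) (fun _ _ _ => sqNorm_nonneg _) (fun _ _ _ => sqNorm_nonneg _)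
    (fun x _ => h.sum_sqNorm_le x) (fun x _ => h.sum_sqNorm_le x) (fun _ _ => le_rfl)
    (fun _ _ => le_rfl) (fun _ _ _ => norm_tensorForm_le O _ _)

omit [Fintype ι] [DecidableEq ι] [DecidableEq A] in
lemma pairForm_eq (α β : κ ⊕ κ → ι) :
    pairForm O p u α β = ∑ r : X × X, ((p r.1 * p r.2 : ℝ) : ℂ) *
      (tensorForm O (fun i => u r.1 (α (Sum.inl i))) (fun i => u r.1 (β (Sum.inl i))) *
        conj (tensorForm O (fun i => u r.2 (β (Sum.inr i))) (fun i => u r.2 (α (Sum.inr i))))) := by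
  simp only [pairForm, meanForm, map_sum, map_mul, Complex.conj_ofReal, Finset.sum_mul_sum,
    Fintype.sum_prod_type, Function.comp_apply]
  refine Finset.sum_congr rfl fun x _ => Finset.sum_congr rfl fun y _ => ?_
  push_cast; ring

lemma norm_rearrangementSum_pairForm_sub_le (h : IsOrthogonalFamily p u) :
    ‖rearrangementSum (pairForm O p u) - ∑ π : Equiv.Perm (κ ⊕ κ), ∑ α, pairForm O p u α (α ∘ π)‖ ≤
      (Fintype.card (κ ⊕ κ)).factorial * (Fintype.card (κ ⊕ κ) : ℝ) ^ 2 *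
        (operatorNorm O ^ 2 * (2 * quarticSpread p u)) := by
  have hb := norm_rearrangementSum_sum_sub_le (S := κ ⊕ κ) (Y := X × X) (ι := ι)
    (w := fun r => p r.1 * p r.2) (fun r => mul_nonneg (h.nonneg _) (h.nonneg _))
    (c := fun r α β =>
      tensorForm O (fun i => u r.1 (α (Sum.inl i))) (fun i => u r.1 (β (Sum.inl i))) *
        conj (tensorForm O (fun i => u r.2 (β (Sum.inr i))) (fun i => u r.2 (α (Sum.inr i)))))
    (y := fun r s e => sqNorm (u (Sum.elim (fun _ => r.1) (fun _ => r.2) s) e))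
    (z := fun r s e => sqNorm (u (Sum.elim (fun _ => r.1) (fun _ => r.2) s) e))
    -- The two copies may carry different outcomes. The sum of their fourth moments dominates either
    -- one, whence the factor two after averaging.
    (D := fun r => ∑ e, sqNorm (u r.1 e) ^ 2 + ∑ e, sqNorm (u r.2 e) ^ 2)
    (N := operatorNorm O ^ 2) (sq_nonneg _)
    (fun _ _ _ => sqNorm_nonneg _) (fun _ _ _ => sqNorm_nonneg _)
    (fun r s => h.sum_sqNorm_le _) (fun r s => h.sum_sqNorm_le _) ?_ ?_ ?_
  · simp only [← pairForm_eq] at hb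
    refine hb.trans (le_of_eq ?_)
    congr 2
    simp only [Fintype.sum_prod_type, mul_add, Finset.sum_add_distrib, quarticSpread, two_mul]
    congr 1
    · refine Finset.sum_congr rfl fun x _ => ?_
      rw [← Finset.sum_mul, ← Finset.mul_sum, h.sum_weight, mul_one]
    · rw [Finset.sum_comm]
      refine Finset.sum_congr rfl fun x _ => ?_
      rw [← Finset.sum_mul, ← Finset.sum_mul, h.sum_weight, one_mul]
  · rintro r (s | s)
    · exact le_add_of_nonneg_right (Finset.sum_nonneg fun _ _ => sq_nonneg _)
    · exact le_add_of_nonneg_left (Finset.sum_nonneg fun _ _ => sq_nonneg _)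
  · rintro r (s | s)
    · exact le_add_of_nonneg_right (Finset.sum_nonneg fun _ _ => sq_nonneg _)
    · exact le_add_of_nonneg_left (Finset.sum_nonneg fun _ _ => sq_nonneg _)
  · intro r α β
    rw [norm_mul, RCLike.norm_conj]
    refine (mul_le_mul (norm_tensorForm_le O _ _) (norm_tensorForm_le O _ _) (norm_nonneg _)
      ((norm_nonneg _).trans (norm_tensorForm_le O _ _))).trans (le_of_eq ?_)
    simp only [Fintype.prod_sum_type, Sum.elim_inl, Sum.elim_inr]
    ring

omit [DecidableEq ι] in
-- The outputs permute the inputs, so the square roots pair up to `∏ i, sqNorm (u x (α i))`, whose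
-- sum over `α` is a product of factors at most one.
lemma norm_wickSum_le (h : IsOrthogonalFamily p u) :
    ‖wickSum O p u‖ ≤ (Fintype.card κ).factorial * operatorNorm O := by
  have hσ : ∀ σ : Equiv.Perm κ, ‖∑ α, meanForm O p u α (α ∘ σ)‖ ≤ operatorNorm O := by
    intro σ
    have hx : ∀ x, ∑ α : κ → ι, ‖tensorForm O (fun i => u x (α i)) (fun i => u x ((α ∘ σ) i))‖ ≤
        operatorNorm O := by
      intro x
      calc ∑ α : κ → ι, ‖tensorForm O (fun i => u x (α i)) (fun i => u x ((α ∘ σ) i))‖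
          ≤ ∑ α : κ → ι, operatorNorm O * ∏ i, sqNorm (u x (α i)) := by
            refine Finset.sum_le_sum fun α _ => (norm_tensorForm_le O _ _).trans (le_of_eq ?_)
            simp only [Function.comp_apply]
            rw [Equiv.prod_comp σ fun i => √(sqNorm (u x (α i))), ← Finset.prod_mul_distrib]
            simp only [Real.mul_self_sqrt (sqNorm_nonneg _)]
        _ = operatorNorm O * ∏ _i : κ, ∑ e, sqNorm (u x e) := by
            rw [← Finset.mul_sum, Finset.prod_univ_sum, Fintype.piFinset_univ]
        _ ≤ operatorNorm O * 1 := by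
            refine mul_le_mul_of_nonneg_left (Finset.prod_le_one (fun _ _ => ?_) fun _ _ => ?_)
              (operatorNorm_nonneg O)
            · exact Finset.sum_nonneg fun _ _ => sqNorm_nonneg _
            · exact h.sum_sqNorm_le x
        _ = operatorNorm O := mul_one _
    calc ‖∑ α, meanForm O p u α (α ∘ σ)‖
        ≤ ∑ α, ∑ x, p x * ‖tensorForm O (fun i => u x (α i)) (fun i => u x ((α ∘ σ) i))‖ := by
          refine (norm_sum_le _ _).trans (Finset.sum_le_sum fun α _ =>
            (norm_sum_le _ _).trans (Finset.sum_le_sum fun x _ => ?_))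
          rw [norm_mul, Complex.norm_real, Real.norm_of_nonneg (h.nonneg x)]
      _ = ∑ x, p x * ∑ α, ‖tensorForm O (fun i => u x (α i)) (fun i => u x ((α ∘ σ) i))‖ := by
          rw [Finset.sum_comm]
          simp only [Finset.mul_sum]
      _ ≤ ∑ x, p x * operatorNorm O :=
          Finset.sum_le_sum fun x _ => mul_le_mul_of_nonneg_left (hx x) (h.nonneg x)
      _ = operatorNorm O := by rw [← Finset.sum_mul, h.sum_weight, one_mul]
  refine (norm_sum_le _ _).trans ((Finset.sum_le_sum fun σ _ => hσ σ).trans (le_of_eq ?_))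
  simp [Finset.card_univ, Fintype.card_perm]

omit [DecidableEq ι] in
lemma sum_word_sum {R : Type*} [AddCommMonoid R] (g : (κ → ι) → (κ → ι) → R) :
    ∑ α : κ ⊕ κ → ι, g (α ∘ Sum.inl) (α ∘ Sum.inr) = ∑ α, ∑ β, g α β := by
  rw [← Fintype.sum_prod_type']
  exact Fintype.sum_equiv (Equiv.sumArrowEquivProdArrow κ κ ι) _ _ fun α => rfl

omit [DecidableEq ι] [DecidableEq A] in
lemma sum_meanForm_comp (τ : Equiv.Perm κ) :
    ∑ α, meanForm O p u (α ∘ τ) α = ∑ α, meanForm O p u α (α ∘ ⇑τ⁻¹) := by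
  refine Fintype.sum_equiv (Equiv.arrowCongr τ⁻¹ (Equiv.refl ι)) _ _ fun α => ?_
  congr 1
  ext i
  simp [Equiv.arrowCongr, Equiv.Perm.inv_def]

omit [DecidableEq ι] [DecidableEq A] in
lemma sum_pairForm_sumCongr (σ τ : Equiv.Perm κ) :
    ∑ α, pairForm O p u α (α ∘ Equiv.Perm.sumCongr σ τ) =
      (∑ α, meanForm O p u α (α ∘ σ)) * conj (∑ α, meanForm O p u (α ∘ τ) α) := by
  rw [map_sum, Finset.sum_mul_sum, ← sum_word_sum]
  rfl

omit [DecidableEq ι] [DecidableEq A] in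
-- A pairing that preserves both copies factors into one permutation for each. In the conjugated
-- copy inputs and outputs are exchanged, which replaces `τ` by its inverse and does not affect the
-- sum over all `τ`.
lemma sum_pairForm_range_sumCongrHom [DecidablePred (· ∈ (Equiv.Perm.sumCongrHom κ κ).range)] :
    ∑ π : Equiv.Perm (κ ⊕ κ) with π ∈ (Equiv.Perm.sumCongrHom κ κ).range,
      ∑ α, pairForm O p u α (α ∘ π) = wickSum O p u * conj (wickSum O p u) := by
  classical
  have hinv : ∑ τ : Equiv.Perm κ, ∑ α, meanForm O p u α (α ∘ ⇑τ⁻¹) = wickSum O p u :=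
    Equiv.sum_comp (Equiv.inv (Equiv.Perm κ)) (fun τ => ∑ α, meanForm O p u α (α ∘ ⇑τ))
  have h1 : wickSum O p u * conj (wickSum O p u) =
      ∑ q : Equiv.Perm κ × Equiv.Perm κ, ∑ α, pairForm O p u α (α ∘ Equiv.Perm.sumCongr q.1 q.2) := by
    simp only [sum_pairForm_sumCongr, sum_meanForm_comp, Fintype.sum_prod_type]
    rw [← Finset.sum_mul_sum, ← map_sum, hinv]
    rfl
  rw [h1]
  symm
  refine Finset.sum_bij (fun q _ => Equiv.Perm.sumCongrHom κ κ q) ?_ ?_ ?_ ?_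
  · intro q _
    simp
  · intro q _ r _ hqr
    exact Equiv.Perm.sumCongrHom_injective hqr
  · intro π hπ
    obtain ⟨q, hq⟩ := (Finset.mem_filter.1 hπ).2
    exact ⟨q, Finset.mem_univ _, hq⟩
  · intro q _
    rfl

omit [DecidableEq A] in
/-- The sum over the energies, for a fixed pairing, is an average over independent signs. -/
lemma sum_signs_eq (π : Equiv.Perm (κ ⊕ κ)) :
    ∑ ε : κ ⊕ κ → ι → ℤˣ, (∏ _s : κ ⊕ κ, (signWeight ι : ℂ)) *
      ((∑ x, (p x : ℂ) * tensorForm O (fun i => signSum (u x) (ε (Sum.inl i)))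
          (fun i => signSum (u x) (ε (π (Sum.inl i))))) *
        conj (∑ x, (p x : ℂ) * tensorForm O (fun i => signSum (u x) (ε (π (Sum.inr i))))
          (fun i => signSum (u x) (ε (Sum.inr i))))) =
      ∑ α, pairForm O p u α (α ∘ π) := by
  have h1 : ∀ ε : κ ⊕ κ → ι → ℤˣ, ∀ l m : κ → κ ⊕ κ,
      ∑ x, (p x : ℂ) * tensorForm O (fun i => signSum (u x) (ε (l i)))
          (fun i => signSum (u x) (ε (m i))) =
        ∑ α : κ → ι, ∑ β : κ → ι, (∏ i, sgn (ε (l i)) (α i)) * (∏ i, sgn (ε (m i)) (β i)) *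
          meanForm O p u α β := by
    intro ε l m
    unfold signSum
    simp only [tensorForm_sum, meanForm, Finset.mul_sum, map_prod, conj_sgn]
    rw [Finset.sum_comm]
    refine Finset.sum_congr rfl fun α _ => ?_
    rw [Finset.sum_comm]
    refine Finset.sum_congr rfl fun β _ => Finset.sum_congr rfl fun x _ => ?_
    ring
  have h2 : ∀ ε : κ ⊕ κ → ι → ℤˣ,
      (∑ x, (p x : ℂ) * tensorForm O (fun i => signSum (u x) (ε (Sum.inl i)))
          (fun i => signSum (u x) (ε (π (Sum.inl i))))) *
        conj (∑ x, (p x : ℂ) * tensorForm O (fun i => signSum (u x) (ε (π (Sum.inr i))))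
          (fun i => signSum (u x) (ε (Sum.inr i)))) =
      ∑ α : κ ⊕ κ → ι, ∑ β : κ ⊕ κ → ι, (∏ s, sgn (ε s) (α s)) * (∏ s, sgn (ε (π s)) (β s)) *
        pairForm O p u α β := by
    intro ε
    rw [h1, h1]
    simp only [Fintype.prod_sum_type, pairForm]
    refine Eq.trans ?_ (Finset.sum_congr rfl fun α _ => sum_word_sum
      fun β γ => ((∏ i, sgn (ε (Sum.inl i)) (α (Sum.inl i))) *
        ∏ i, sgn (ε (Sum.inr i)) (α (Sum.inr i))) * ((∏ i, sgn (ε (π (Sum.inl i))) (β i)) *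
        ∏ i, sgn (ε (π (Sum.inr i))) (γ i)) * (meanForm O p u (α ∘ Sum.inl) β *
        conj (meanForm O p u γ (α ∘ Sum.inr)))).symm
    refine Eq.trans ?_ (sum_word_sum fun α δ => ∑ β, ∑ γ, ((∏ i, sgn (ε (Sum.inl i)) (α i)) *
        ∏ i, sgn (ε (Sum.inr i)) (δ i)) * ((∏ i, sgn (ε (π (Sum.inl i))) (β i)) *
        ∏ i, sgn (ε (π (Sum.inr i))) (γ i)) * (meanForm O p u α β *
        conj (meanForm O p u γ δ))).symm
    simp only [map_sum, map_mul, map_prod, conj_sgn, Finset.sum_mul,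
      Finset.mul_sum]
    rw [sum_comm_four]
    refine Finset.sum_congr rfl fun α _ => ?_
    refine (Finset.sum_congr rfl fun β _ => Finset.sum_comm).trans ?_
    refine Finset.sum_comm.trans ?_
    refine Finset.sum_congr rfl fun δ _ => Finset.sum_congr rfl fun β _ =>
      Finset.sum_congr rfl fun γ _ => ?_
    ring
  simp only [h2]
  calc ∑ ε : κ ⊕ κ → ι → ℤˣ, (∏ _s : κ ⊕ κ, (signWeight ι : ℂ)) *
      ∑ α : κ ⊕ κ → ι, ∑ β : κ ⊕ κ → ι, (∏ s, sgn (ε s) (α s)) * (∏ s, sgn (ε (π s)) (β s)) *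
        pairForm O p u α β
      = ∑ α : κ ⊕ κ → ι, ∑ β : κ ⊕ κ → ι, (∑ ε : κ ⊕ κ → ι → ℤˣ, ∏ s, (signWeight ι : ℂ) *
          (sgn (ε s) (α s) * sgn (ε s) (β (π.symm s)))) * pairForm O p u α β := by
        simp only [Finset.mul_sum, Finset.sum_mul]
        rw [Finset.sum_comm]
        refine Finset.sum_congr rfl fun α _ => ?_
        rw [Finset.sum_comm]
        refine Finset.sum_congr rfl fun β _ => Finset.sum_congr rfl fun ε _ => ?_
        rw [Finset.prod_mul_distrib, Finset.prod_mul_distrib,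
          ← Equiv.prod_comp π fun s => sgn (ε s) (β (π.symm s))]
        simp only [Equiv.symm_apply_apply]
        ring
    _ = ∑ α : κ ⊕ κ → ι, ∑ β : κ ⊕ κ → ι, (if β = α ∘ π then 1 else 0) * pairForm O p u α β := by
        refine Finset.sum_congr rfl fun α _ => Finset.sum_congr rfl fun β _ => ?_
        congr 1
        -- Independence gives one factor for each `s`, and orthonormality of the signs makes it the
        -- Kronecker delta of `α s` and `β (π⁻¹ s)`.
        rw [sum_prod_signs (fun s ω => (signWeight ι : ℂ) * (sgn ω (α s) * sgn ω (β (π.symm s))))]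
        simp only [sum_sgn_mul_sgn]
        split_ifs with hβ
        · refine Finset.prod_eq_one fun s _ => ?_
          rw [if_pos]
          simp [hβ]
        · obtain ⟨s, hs⟩ : ∃ s, β s ≠ α (π s) := by
            by_contra! hne
            exact hβ (funext hne)
          refine Finset.prod_eq_zero (Finset.mem_univ (π s)) ?_
          rw [if_neg]
          simpa using hs.symm
    _ = _ := by simp [ite_mul]

end Variance

/-! ### Pairings that mix the two copies, and the mean square deviation -/

section CrossPairings

variable {ι X A κ : Type*} [Fintype ι] [DecidableEq ι] [Fintype X] [Fintype A] [DecidableEq A]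
  [Fintype κ] [DecidableEq κ] {p : X → ℝ} {u : X → ι → A → ℂ} (O : Matrix (κ → A) (κ → A) ℂ)

/-- The sum of the squares of the weights `∑ₓ p(x) ‖u x e‖²`. -/
noncomputable def purity (p : X → ℝ) (u : X → ι → A → ℂ) : ℝ :=
  ∑ e, (∑ x, p x * sqNorm (u x e)) ^ 2

omit [DecidableEq ι] [DecidableEq A] in
lemma purity_le (h : IsOrthogonalFamily p u) : purity p u ≤ quarticSpread p u := by
  have hx : quarticSpread p u = ∑ e, ∑ x, p x * sqNorm (u x e) ^ 2 := by
    rw [Finset.sum_comm]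
    simp only [quarticSpread, Finset.mul_sum]
  rw [hx]
  refine Finset.sum_le_sum fun e _ => ?_
  exact Real.pow_arith_mean_le_arith_mean_pow Finset.univ p (fun x => sqNorm (u x e))
    (fun x _ => h.nonneg x) h.sum_weight (fun x _ => sqNorm_nonneg _) 2

omit [Fintype κ] [DecidableEq κ] in
lemma prod_comp_le_prod {S : Type*} [Fintype S] [DecidableEq S] {y : S → ℝ} (hy : ∀ s, 1 ≤ y s)
    {l : κ → S} (hl : Function.Injective l) (t : Finset κ) : ∏ i ∈ t, y (l i) ≤ ∏ s, y s := by
  rw [← Finset.prod_image (s := t) (g := l) (f := y) (fun _ _ _ _ h => hl h),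
    ← Finset.prod_mul_prod_compl (t.image l) y]
  refine le_mul_of_one_le_right (Finset.prod_nonneg fun s _ => zero_le_one.trans (hy s)) ?_
  exact Finset.prod_induction y (fun r => 1 ≤ r) (fun a b ha hb => one_le_mul_of_one_le_of_one_le ha hb)
    le_rfl fun s _ => hy s

variable {S : Type*} [Fintype S] [DecidableEq S]

/-- A bound for the total squared norm of the random vectors, at least one in each slot. -/
noncomputable def slotBound (u : ι → A → ℂ) (ε : S → ι → ℤˣ) : ℝ :=
  ∏ s, max 1 (sqNorm (signSum u (ε s)))

omit [DecidableEq A] in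
-- Each slot costs `1 + 3`, from `max 1 r ^ 2 ≤ 1 + r ^ 2` and the fourth-moment bound. The maximum
-- with one is what allows `slotBound` to dominate the product over any subset of the slots.
lemma sum_slotBound_sq_le {v : ι → A → ℂ} (hv : ∑ e, sqNorm (v e) ≤ 1) :
    ∑ ε : S → ι → ℤˣ, (∏ _s : S, signWeight ι) * slotBound v ε ^ 2 ≤ 4 ^ Fintype.card S := by
  have h0 : 0 ≤ ∑ e, sqNorm (v e) := Finset.sum_nonneg fun _ _ => sqNorm_nonneg _
  simp only [slotBound, ← Finset.prod_pow, ← Finset.prod_mul_distrib]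
  rw [sum_prod_signs (fun _ ω => signWeight ι * max 1 (sqNorm (signSum v ω)) ^ 2),
    Finset.prod_const, Finset.card_univ]
  refine pow_le_pow_left₀ (Finset.sum_nonneg fun ω _ =>
    mul_nonneg signWeight_pos.le (sq_nonneg _)) ?_ _
  calc ∑ ω : ι → ℤˣ, signWeight ι * max 1 (sqNorm (signSum v ω)) ^ 2
      ≤ ∑ ω : ι → ℤˣ, (signWeight ι + signWeight ι * sqNorm (signSum v ω) ^ 2) := by
        refine Finset.sum_le_sum fun ω _ => ?_
        rw [← mul_one_add]
        refine mul_le_mul_of_nonneg_left ?_ signWeight_pos.le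
        rcases max_choice 1 (sqNorm (signSum v ω)) with hm | hm <;> rw [hm]
        · nlinarith [sq_nonneg (sqNorm (signSum v ω))]
        · linarith
    _ ≤ 1 + 3 * (∑ e, sqNorm (v e)) ^ 2 := by
        rw [Finset.sum_add_distrib, sum_signWeight]
        gcongr
        exact sum_sqNorm_signSum_sq_le v
    _ ≤ 4 := by nlinarith

/-- The input sign vector `l i` is used by no output, and the output one `m j` by no input.
Conditionally on all the others, the form is bilinear in these two, so averaging its square over
them gives the sum of squares bounded by `sum_norm_form_sq_le`. The other slots enter only through
`slotBound`, whose mean square is bounded uniformly in `x`. -/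
lemma sum_signs_norm_sq_le (h : IsOrthogonalFamily p u) {l m : κ → S}
    (hl : Function.Injective l) (hm : Function.Injective m) {i j : κ} (hml : ∀ r, m r ≠ l i)
    (hlm : ∀ r, l r ≠ m j) :
    ∑ ε : S → ι → ℤˣ, (∏ _s : S, signWeight ι) *
      ‖∑ x, (p x : ℂ) * tensorForm O (fun r => signSum (u x) (ε (l r)))
        (fun r => signSum (u x) (ε (m r)))‖ ^ 2 ≤
      operatorNorm O ^ 2 * 4 ^ Fintype.card S * purity p u := by
  set W : ℝ := ∏ _s : S, signWeight ι with hW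
  have hW0 : 0 ≤ W := Finset.prod_nonneg fun _ _ => signWeight_pos.le
  let M : (S → ι → ℤˣ) → X → Matrix A A ℂ := fun ε x =>
    slotMatrix O (fun r => signSum (u x) (ε (l r))) (fun r => signSum (u x) (ε (m r))) i j
  have hupd : ∀ (ε : S → ι → ℤˣ) (ω ω' : ι → ℤˣ),
      ∑ x, (p x : ℂ) * tensorForm O
        (fun r => signSum (u x) (Function.update (Function.update ε (l i) ω) (m j) ω' (l r)))
        (fun r => signSum (u x) (Function.update (Function.update ε (l i) ω) (m j) ω' (m r))) =
      ∑ e, ∑ f, sgn ω e * sgn ω' f *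
        ∑ x, (p x : ℂ) * (star (u x f) ⬝ᵥ M ε x *ᵥ u x e) := by
    intro ε ω ω'
    have hx : ∀ x, tensorForm O
        (fun r => signSum (u x) (Function.update (Function.update ε (l i) ω) (m j) ω' (l r)))
        (fun r => signSum (u x) (Function.update (Function.update ε (l i) ω) (m j) ω' (m r))) =
        ∑ e, ∑ f, sgn ω e * sgn ω' f * (star (u x f) ⬝ᵥ M ε x *ᵥ u x e) := by
      intro x
      have e1 : (fun r => signSum (u x) (Function.update (Function.update ε (l i) ω) (m j) ω' (l r)))
          = Function.update (fun r => signSum (u x) (ε (l r))) i (signSum (u x) ω) := by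
        ext1 r
        rw [Function.update_of_ne (hlm r)]
        by_cases hr : r = i
        · subst hr; simp
        · rw [Function.update_of_ne (fun hh => hr (hl hh)), Function.update_of_ne hr]
      have e2 : (fun r => signSum (u x) (Function.update (Function.update ε (l i) ω) (m j) ω' (m r)))
          = Function.update (fun r => signSum (u x) (ε (m r))) j (signSum (u x) ω') := by
        ext1 r
        by_cases hr : r = j
        · subst hr; simp
        · rw [Function.update_of_ne (fun hh => hr (hm hh)), Function.update_of_ne (hml r),
            Function.update_of_ne hr]
      rw [e1, e2, tensorForm_update, signSum_eq, signSum_eq, star_sum, Matrix.mulVec_sum,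
        sum_dotProduct, Finset.sum_comm]
      refine Finset.sum_congr rfl fun f _ => ?_
      rw [dotProduct_sum]
      refine Finset.sum_congr rfl fun e _ => ?_
      rw [star_smul, Matrix.mulVec_smul, smul_dotProduct, dotProduct_smul, smul_eq_mul, smul_eq_mul,
        RCLike.star_def, conj_sgn]
      ring
    simp only [hx, Finset.mul_sum]
    rw [Finset.sum_comm]
    refine Finset.sum_congr rfl fun e _ => ?_
    rw [Finset.sum_comm]
    refine Finset.sum_congr rfl fun f _ => Finset.sum_congr rfl fun x _ => ?_
    ring
  have hM : ∀ ε x v w, ‖star w ⬝ᵥ M ε x *ᵥ v‖ ^ 2 ≤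
      (operatorNorm O ^ 2 * slotBound (u x) ε ^ 2) * (sqNorm v * sqNorm w) := by
    intro ε x v w
    refine (norm_slotMatrix_sq_le O _ _ i j v w).trans ?_
    have hprod : ∀ {q : κ → S} (_ : Function.Injective q) (t : Finset κ),
        ∏ r ∈ t, sqNorm (signSum (u x) (ε (q r))) ≤ slotBound (u x) ε := fun {q} hq t =>
      (Finset.prod_le_prod (fun _ _ => sqNorm_nonneg _) fun r _ => le_max_right 1 _).trans
        (prod_comp_le_prod (y := fun s => max 1 (sqNorm (signSum (u x) (ε s))))
          (fun s => le_max_left _ _) hq t)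
    have hs0 : 0 ≤ slotBound (u x) ε :=
      Finset.prod_nonneg fun s _ => zero_le_one.trans (le_max_left _ _)
    refine mul_le_mul_of_nonneg_right (mul_le_mul_of_nonneg_left ?_ (sq_nonneg _))
      (mul_nonneg (sqNorm_nonneg _) (sqNorm_nonneg _))
    rw [sq]
    exact mul_le_mul (hprod hl _) (hprod hm _)
      (Finset.prod_nonneg fun _ _ => sqNorm_nonneg _) hs0
  -- Fresh signs are drawn at the two unpaired slots; `M ε x` still depends on the old `ε`.
  rw [← Finset.mul_sum, ← sum_resample_signs _ (m j)]
  rw [← sum_resample_signs _ (l i)]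
  simp only [hupd]
  have hsq : ∀ ε : S → ι → ℤˣ, ∑ ω : ι → ℤˣ, signWeight ι * ∑ ω' : ι → ℤˣ, signWeight ι *
      ‖∑ e, ∑ f, sgn ω e * sgn ω' f * ∑ x, (p x : ℂ) * (star (u x f) ⬝ᵥ M ε x *ᵥ u x e)‖ ^ 2 ≤
      ∑ e, (∑ x, p x * sqNorm (u x e)) * ∑ x, p x *
        ((operatorNorm O ^ 2 * slotBound (u x) ε ^ 2) * sqNorm (u x e)) := by
    intro ε
    rw [sum_norm_sgn_sum_sum_sq (fun e f => ∑ x, (p x : ℂ) * (star (u x f) ⬝ᵥ M ε x *ᵥ u x e))]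
    exact sum_norm_form_sq_le h.nonneg h.orthogonal (M ε) (hM ε)
  calc W * ∑ ε : S → ι → ℤˣ, ∑ ω : ι → ℤˣ, signWeight ι * ∑ ω' : ι → ℤˣ, signWeight ι *
      ‖∑ e, ∑ f, sgn ω e * sgn ω' f * ∑ x, (p x : ℂ) * (star (u x f) ⬝ᵥ M ε x *ᵥ u x e)‖ ^ 2
      ≤ W * ∑ ε : S → ι → ℤˣ, ∑ e, (∑ x, p x * sqNorm (u x e)) * ∑ x, p x *
        ((operatorNorm O ^ 2 * slotBound (u x) ε ^ 2) * sqNorm (u x e)) :=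
        mul_le_mul_of_nonneg_left (Finset.sum_le_sum fun ε _ => hsq ε) hW0
    _ = ∑ e, (∑ x, p x * sqNorm (u x e)) * ∑ x, p x * sqNorm (u x e) * (operatorNorm O ^ 2 *
          ∑ ε : S → ι → ℤˣ, W * slotBound (u x) ε ^ 2) := by
        simp only [Finset.mul_sum]
        rw [Finset.sum_comm]
        refine Finset.sum_congr rfl fun e _ => ?_
        rw [Finset.sum_comm]
        refine Finset.sum_congr rfl fun x _ => Finset.sum_congr rfl fun ε _ => ?_
        ring
    _ ≤ ∑ e, (∑ x, p x * sqNorm (u x e)) * ∑ x, p x * sqNorm (u x e) * (operatorNorm O ^ 2 *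
          4 ^ Fintype.card S) := by
        refine Finset.sum_le_sum fun e _ => mul_le_mul_of_nonneg_left
          (Finset.sum_le_sum fun x _ => mul_le_mul_of_nonneg_left (mul_le_mul_of_nonneg_left
            (sum_slotBound_sq_le (h.sum_sqNorm_le x)) (sq_nonneg _))
            (mul_nonneg (h.nonneg x) (sqNorm_nonneg _)))
          (Finset.sum_nonneg fun x _ => mul_nonneg (h.nonneg x) (sqNorm_nonneg _))
    _ = _ := by
        simp only [← Finset.sum_mul, purity, sq]
        rw [Finset.mul_sum]
        refine Finset.sum_congr rfl fun e _ => ?_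
        ring

/-- A pairing that mixes the copies sends some slot from left to right and, by counting, some slot
from right to left. In each copy this leaves one input and one output without a partner in that
copy, as `sum_signs_norm_sq_le` requires. -/
lemma norm_sum_pairForm_le (h : IsOrthogonalFamily p u) {π : Equiv.Perm (κ ⊕ κ)}
    (hπ : π ∉ (Equiv.Perm.sumCongrHom κ κ).range) :
    ‖∑ α, pairForm O p u α (α ∘ π)‖ ≤
      operatorNorm O ^ 2 * 4 ^ Fintype.card (κ ⊕ κ) * quarticSpread p u := by
  obtain ⟨i, j, hij⟩ : ∃ i j, π (Sum.inl i) = Sum.inr j := by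
    by_contra! hne
    refine hπ (Equiv.Perm.mem_sumCongrHom_range_of_perm_mapsTo_inl ?_)
    rintro _ ⟨i, rfl⟩
    rcases hr : π (Sum.inl i) with r | r
    · exact ⟨r, rfl⟩
    · exact absurd hr (hne i r)
  obtain ⟨i', j', hij'⟩ : ∃ i' j', π (Sum.inr i') = Sum.inl j' := by
    by_contra! hne
    have hg : ∀ r, ∃ q, π (Sum.inr r) = Sum.inr q := by
      intro r
      rcases hr : π (Sum.inr r) with q | q
      · exact absurd hr (hne r q)
      · exact ⟨q, rfl⟩
    choose g hg using hg
    have hinj : Function.Injective g := fun a b hab =>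
      Sum.inr_injective (π.injective ((hg a).trans ((congrArg Sum.inr hab).trans (hg b).symm)))
    obtain ⟨a, ha⟩ := Finite.surjective_of_injective hinj j
    have := π.injective (hij.trans ((congrArg Sum.inr ha.symm).trans (hg a).symm))
    simp at this
  rw [← sum_signs_eq]
  have hA := sum_signs_norm_sq_le O h (l := Sum.inl) (m := fun r => π (Sum.inl r)) (i := j') (j := i)
    Sum.inl_injective (π.injective.comp Sum.inl_injective) (fun r hr => by
      have := π.injective (hr.trans hij'.symm)
      simp at this) (fun r hr => by simp [hij] at hr)
  have hB := sum_signs_norm_sq_le O h (l := fun r => π (Sum.inr r)) (m := Sum.inr) (i := i') (j := j)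
    (π.injective.comp Sum.inr_injective) Sum.inr_injective (fun r hr => by simp [hij'] at hr)
    (fun r hr => by
      have := π.injective (hr.trans hij.symm)
      simp at this)
  have hpur : operatorNorm O ^ 2 * 4 ^ Fintype.card (κ ⊕ κ) * purity p u ≤
      operatorNorm O ^ 2 * 4 ^ Fintype.card (κ ⊕ κ) * quarticSpread p u :=
    mul_le_mul_of_nonneg_left (purity_le h) (by positivity)
  have hW0 : 0 ≤ ∏ _s : κ ⊕ κ, signWeight ι := Finset.prod_nonneg fun _ _ => signWeight_pos.le
  -- The two copies share sign vectors and are not independent; `2ab ≤ a² + b²` separates them.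
  calc _ ≤ ∑ ε : κ ⊕ κ → ι → ℤˣ, (1 / 2) * ((∏ _s : κ ⊕ κ, signWeight ι) *
        ‖∑ x, (p x : ℂ) * tensorForm O (fun r => signSum (u x) (ε (Sum.inl r)))
          (fun r => signSum (u x) (ε (π (Sum.inl r))))‖ ^ 2 + (∏ _s : κ ⊕ κ, signWeight ι) *
        ‖∑ x, (p x : ℂ) * tensorForm O (fun r => signSum (u x) (ε (π (Sum.inr r))))
          (fun r => signSum (u x) (ε (Sum.inr r)))‖ ^ 2) := by
        refine (norm_sum_le _ _).trans (Finset.sum_le_sum fun ε _ => ?_)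
        rw [norm_mul, norm_mul, RCLike.norm_conj, ← Complex.ofReal_prod, Complex.norm_real,
          Real.norm_of_nonneg hW0, ← mul_add, mul_left_comm (1 / 2 : ℝ)]
        refine mul_le_mul_of_nonneg_left ?_ hW0
        nlinarith [two_mul_le_add_sq
          ‖∑ x, (p x : ℂ) * tensorForm O (fun r => signSum (u x) (ε (Sum.inl r)))
            (fun r => signSum (u x) (ε (π (Sum.inl r))))‖
          ‖∑ x, (p x : ℂ) * tensorForm O (fun r => signSum (u x) (ε (π (Sum.inr r))))
            (fun r => signSum (u x) (ε (Sum.inr r)))‖]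
    _ ≤ _ := by
        rw [← Finset.mul_sum, Finset.sum_add_distrib]
        linarith

/-- The constant in the bound for the mean square deviation of a random-phase form of degree
`(m, m)` from its Gaussian average. -/
noncomputable def deviationConst (m : ℕ) : ℝ :=
  (2 * m).factorial * (2 * m : ℝ) ^ 2 * 2 + (2 * m).factorial * 4 ^ (2 * m) +
    2 * (m.factorial * m.factorial * (m : ℝ) ^ 2)

lemma deviationConst_nonneg (m : ℕ) : 0 ≤ deviationConst m := by
  unfold deviationConst
  positivity

/-- If the phases are averaged out, the form deviates from its Gaussian average by a quantity
controlled by `quarticSpread`. -/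
lemma re_deviation_le (h : IsOrthogonalFamily p u) :
    (rearrangementSum (pairForm O p u) - conj (wickSum O p u) * rearrangementSum (meanForm O p u) -
        wickSum O p u * conj (rearrangementSum (meanForm O p u)) +
        wickSum O p u * conj (wickSum O p u)).re ≤
      deviationConst (Fintype.card κ) * (operatorNorm O ^ 2 * quarticSpread p u) := by
  classical
  have h1 := norm_rearrangementSum_pairForm_sub_le O h
  have h2 := norm_rearrangementSum_meanForm_sub_le O h
  have h3 := norm_wickSum_le O h
  have h4 : ‖∑ π : Equiv.Perm (κ ⊕ κ) with π ∉ (Equiv.Perm.sumCongrHom κ κ).range,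
      ∑ α, pairForm O p u α (α ∘ π)‖ ≤ (Fintype.card (κ ⊕ κ)).factorial *
        (operatorNorm O ^ 2 * 4 ^ Fintype.card (κ ⊕ κ) * quarticSpread p u) := by
    have hnn : 0 ≤ operatorNorm O ^ 2 * 4 ^ Fintype.card (κ ⊕ κ) * quarticSpread p u := by
      have : 0 ≤ quarticSpread p u := Finset.sum_nonneg fun x _ =>
        mul_nonneg (h.nonneg x) (Finset.sum_nonneg fun _ _ => sq_nonneg _)
      positivity
    refine (norm_sum_le _ _).trans ((Finset.sum_le_sum fun π hπ =>
      norm_sum_pairForm_le O h (Finset.mem_filter.1 hπ).2).trans ?_)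
    rw [Finset.sum_const, nsmul_eq_mul, ← Fintype.card_perm]
    exact mul_le_mul_of_nonneg_right (Nat.cast_le.2 (Finset.card_le_univ _)) hnn
  have hsplit := Finset.sum_filter_add_sum_filter_not Finset.univ
    (fun π : Equiv.Perm (κ ⊕ κ) => π ∈ (Equiv.Perm.sumCongrHom κ κ).range)
    (fun π => ∑ α, pairForm O p u α (α ∘ π))
  rw [sum_pairForm_range_sumCongrHom] at hsplit
  rw [← hsplit] at h1
  have hcard : Fintype.card (κ ⊕ κ) = 2 * Fintype.card κ := by
    rw [Fintype.card_sum, two_mul]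
  rw [hcard] at h1 h4
  generalize (∑ π : Equiv.Perm (κ ⊕ κ) with π ∉ (Equiv.Perm.sumCongrHom κ κ).range,
      ∑ α, pairForm O p u α (α ∘ π)) = R at *
  generalize rearrangementSum (pairForm O p u) = P at *
  generalize rearrangementSum (meanForm O p u) = Q at *
  generalize wickSum O p u = G at *
  -- Here `P` and `Q` are the time averages of `|f|²` and `f`, and `R` collects the cross pairings.
  -- Replacing `P` by `|G|² + R` and `Q` by `G` leaves only small terms.
  have hid : P - conj G * Q - G * conj Q + G * conj G =
      (P - (G * conj G + R)) + R - conj G * (Q - G) - G * conj (Q - G) := by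
    rw [map_sub]; ring
  have hprod : ‖G‖ * ‖Q - G‖ ≤ ((Fintype.card κ).factorial * operatorNorm O) *
      ((Fintype.card κ).factorial * (Fintype.card κ : ℝ) ^ 2 *
        (operatorNorm O * quarticSpread p u)) :=
    mul_le_mul h3 h2 (norm_nonneg _) ((norm_nonneg _).trans h3)
  refine (Complex.re_le_norm _).trans ?_
  rw [hid]
  refine (norm_sub_le _ _).trans ?_
  refine (add_le_add_left (norm_sub_le _ _) _).trans ?_
  refine (add_le_add_left (add_le_add_left (norm_add_le _ _) _) _).trans ?_
  rw [norm_mul, norm_mul, RCLike.norm_conj, RCLike.norm_conj]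
  -- The three summands come from repeated letters in `|f|²`, from the cross pairings, and from
  -- repeated letters in `f`. The last is multiplied by `‖G‖` and occurs twice.
  unfold deviationConst
  push_cast at h1 h4 ⊢
  linarith

end CrossPairings

/-! ### Time averages -/

section TimeAverage

lemma tendsto_average_exp (r : ℝ) :
    Tendsto (fun T : ℝ => (T : ℂ)⁻¹ * ∫ t in (0 : ℝ)..T, Complex.exp (-Complex.I * (r * t))) atTop
      (nhds (if r = 0 then 1 else 0)) := by
  split_ifs with hr
  · subst hr
    refine tendsto_const_nhds.congr' ?_
    filter_upwards [eventually_gt_atTop 0] with T hT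
    have : (T : ℂ) ≠ 0 := Complex.ofReal_ne_zero.2 hT.ne'
    simp [this]
  · have hc : -Complex.I * r ≠ 0 := by simp [hr]
    have hint : ∀ T : ℝ, ∫ t in (0 : ℝ)..T, Complex.exp (-Complex.I * (r * t)) =
        (Complex.exp (-Complex.I * r * T) - 1) / (-Complex.I * r) := by
      intro T
      have := integral_exp_mul_complex (a := 0) (b := T) hc
      simp only [mul_assoc] at this ⊢
      rw [this]
      simp
    rw [tendsto_zero_iff_norm_tendsto_zero]
    refine squeeze_zero' (g := fun T : ℝ => T⁻¹ * (2 / |r|)) (.of_forall fun T => norm_nonneg _) ?_ ?_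
    · filter_upwards [eventually_gt_atTop 0] with T hT
      rw [hint, norm_mul, norm_inv, Complex.norm_real, Real.norm_of_nonneg hT.le, norm_div]
      refine mul_le_mul_of_nonneg_left ?_ (inv_nonneg.2 hT.le)
      have h1 : ‖-Complex.I * (r : ℂ)‖ = |r| := by simp
      have h2 : ‖Complex.exp (-Complex.I * r * T)‖ = 1 := by
        rw [Complex.norm_exp]; simp
      rw [h1]
      refine div_le_div_of_nonneg_right ?_ (abs_nonneg r)
      refine (norm_sub_le _ _).trans ?_
      rw [h2]; norm_num
    · simpa using tendsto_inv_atTop_zero.mul_const (2 / |r|)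

/-- Markov's inequality on `[0, T]`. The strict inequality `L < c ^ 2 * δ` makes the finite-time
mean fall below `c ^ 2 * δ` for large `T`. -/
lemma holdsExceptFraction_of_tendsto {g : ℝ → ℝ} (hg : Continuous g) (hg0 : ∀ t, 0 ≤ g t) {L : ℝ}
    (hL : Tendsto (fun T : ℝ => T⁻¹ * ∫ t in (0 : ℝ)..T, g t) atTop (nhds L)) {c δ : ℝ} (hc : 0 < c)
    (hLc : L < c ^ 2 * δ) {P : ℝ → Prop} (hP : ∀ t, g t ≤ c ^ 2 → P t) :
    HoldsExceptFraction δ P := by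
  filter_upwards [hL.eventually (gt_mem_nhds hLc), eventually_gt_atTop 0] with T hT hT0
  have hc2 : 0 < c ^ 2 := by positivity
  have hint : IntegrableOn g (Set.Icc 0 T) := hg.continuousOn.integrableOn_Icc
  have h1 := mul_meas_ge_le_integral_of_nonneg (μ := volume.restrict (Set.Icc 0 T)) (f := g)
    (.of_forall hg0) hint (c ^ 2)
  have h2 : volume.real {t | t ∈ Set.Icc 0 T ∧ ¬ P t} ≤
      (volume.restrict (Set.Icc 0 T)).real {t | c ^ 2 ≤ g t} := by
    rw [measureReal_restrict_apply (measurableSet_le measurable_const hg.measurable)]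
    refine measureReal_mono ?_ ?_
    · rintro t ⟨ht, hPt⟩
      exact ⟨(not_le.1 fun h => hPt (hP t h)).le, ht⟩
    · exact ((measure_mono Set.inter_subset_right).trans_lt measure_Icc_lt_top).ne
  rw [integral_Icc_eq_integral_Ioc, ← intervalIntegral.integral_of_le hT0.le] at h1
  have h3 : ∫ t in (0 : ℝ)..T, g t < c ^ 2 * (δ * T) := by
    rw [inv_mul_lt_iff₀ hT0] at hT
    linarith
  exact h2.trans (le_of_mul_le_mul_left (h1.trans h3.le) hc2)

variable {ι S : Type*} [Fintype ι] [DecidableEq ι] [Fintype S] [DecidableEq S]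

/-- The quasi-periodic function with coefficients `c α β` and frequencies `∑ E (α s) - ∑ E (β s)`. -/
noncomputable def phaseSum (E : ι → ℝ) (c : (S → ι) → (S → ι) → ℂ) (t : ℝ) : ℂ :=
  ∑ α, ∑ β, Complex.exp (-Complex.I * (((∑ s, E (α s) - ∑ s, E (β s) : ℝ) : ℂ) * t)) * c α β

omit [DecidableEq ι] in
lemma continuous_phaseSum (E : ι → ℝ) (c : (S → ι) → (S → ι) → ℂ) :
    Continuous (phaseSum E c) := by
  unfold phaseSum
  fun_prop

lemma tendsto_average_phaseSum {E : ι → ℝ}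
    (hE : ∀ α β : S → ι, ∑ s, E (α s) = ∑ s, E (β s) → ∃ π : Equiv.Perm S, β = α ∘ π)
    (c : (S → ι) → (S → ι) → ℂ) :
    Tendsto (fun T : ℝ => (T : ℂ)⁻¹ * ∫ t in (0 : ℝ)..T, phaseSum E c t) atTop
      (nhds (rearrangementSum c)) := by
  classical
  have hfun : ∀ T : ℝ, (T : ℂ)⁻¹ * ∫ t in (0 : ℝ)..T, phaseSum E c t =
      ∑ α, ∑ β, ((T : ℂ)⁻¹ * ∫ t in (0 : ℝ)..T,
        Complex.exp (-Complex.I * (((∑ s, E (α s) - ∑ s, E (β s) : ℝ) : ℂ) * t))) * c α β := by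
    intro T
    unfold phaseSum
    rw [intervalIntegral.integral_finsetSum, Finset.mul_sum]
    · refine Finset.sum_congr rfl fun α _ => ?_
      rw [intervalIntegral.integral_finsetSum, Finset.mul_sum]
      · refine Finset.sum_congr rfl fun β _ => ?_
        rw [intervalIntegral.integral_mul_const, mul_assoc]
      · intro β _
        exact Continuous.intervalIntegrable (by fun_prop) _ _
    · intro α _
      exact Continuous.intervalIntegrable (by fun_prop) _ _
  simp only [hfun, rearrangementSum]
  refine tendsto_finsetSum _ fun α _ => tendsto_finsetSum _ fun β _ => ?_
  have h := (tendsto_average_exp (∑ s, E (α s) - ∑ s, E (β s))).mul_const (c α β)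
  convert h using 2
  by_cases hαβ : ∃ π : Equiv.Perm S, β = α ∘ π
  · rw [if_pos hαβ, if_pos, one_mul]
    obtain ⟨π, rfl⟩ := hαβ
    rw [sub_eq_zero]
    exact (Equiv.sum_comp π fun s => E (α s)).symm
  · rw [if_neg hαβ, if_neg, zero_mul]
    exact fun h0 => hαβ (hE α β (sub_eq_zero.1 h0))

end TimeAverage

/-! ### Long-time mean of the squared deviation -/

section Deviation

variable {ι X A κ : Type*} [Fintype ι] [DecidableEq ι] [Fintype X] [Fintype A] [DecidableEq A]
  [Fintype κ] [DecidableEq κ] {p : X → ℝ} {u : X → ι → A → ℂ} (O : Matrix (κ → A) (κ → A) ℂ)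

omit [DecidableEq ι] [DecidableEq A] in
lemma sum_tensorForm_evolved (p : X → ℝ) (u : X → ι → A → ℂ) (E : ι → ℝ) (t : ℝ) :
    ∑ x, (p x : ℂ) * tensorForm O
        (fun _ a => ∑ e, Complex.exp (-Complex.I * (E e * t)) * u x e a)
        (fun _ a => ∑ e, Complex.exp (-Complex.I * (E e * t)) * u x e a) =
      phaseSum E (meanForm O p u) t := by
  have hconj : ∀ e, conj (Complex.exp (-Complex.I * (E e * t))) =
      Complex.exp (Complex.I * (E e * t)) := by
    intro e
    rw [← Complex.exp_conj]
    simp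
  simp only [tensorForm_sum, phaseSum, meanForm, Finset.mul_sum]
  rw [Finset.sum_comm]
  refine Finset.sum_congr rfl fun α _ => ?_
  rw [Finset.sum_comm]
  refine Finset.sum_congr rfl fun β _ => Finset.sum_congr rfl fun x _ => ?_
  have hph : (∏ i, Complex.exp (-Complex.I * (E (α i) * t))) *
      conj (∏ i, Complex.exp (-Complex.I * (E (β i) * t))) =
      Complex.exp (-Complex.I * (((∑ s, E (α s) - ∑ s, E (β s) : ℝ) : ℂ) * t)) := by
    rw [map_prod]
    simp only [hconj]
    rw [← Complex.exp_sum, ← Complex.exp_sum, ← Complex.exp_add]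
    congr 1
    push_cast
    rw [← Finset.mul_sum, ← Finset.mul_sum, ← Finset.sum_mul, ← Finset.sum_mul]
    ring
  rw [hph]
  ring

omit [DecidableEq ι] [DecidableEq A] in
-- Conjugation exchanges positive and negative frequencies. Since `pairForm` exchanges the roles of
-- the two words in its second copy, `|f|²` is again a phase sum, on twice as many slots.
lemma phaseSum_mul_conj (E : ι → ℝ) (t : ℝ) :
    phaseSum E (meanForm O p u) t * conj (phaseSum E (meanForm O p u) t) =
      phaseSum E (pairForm O p u) t := by
  have hrhs : phaseSum E (pairForm O p u) t = ∑ α : κ → ι, ∑ δ : κ → ι, ∑ β : κ → ι, ∑ γ : κ → ι,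
      Complex.exp (-Complex.I * (((∑ s, E (α s) + ∑ s, E (δ s) -
        (∑ s, E (β s) + ∑ s, E (γ s)) : ℝ) : ℂ) * t)) *
        (meanForm O p u α β * conj (meanForm O p u γ δ)) := by
    rw [← sum_word_sum]
    unfold phaseSum
    refine Finset.sum_congr rfl fun α _ => ?_
    rw [← sum_word_sum]
    simp only [Fintype.sum_sum_type]
    rfl
  have hconj : ∀ r : ℝ, conj (Complex.exp (-Complex.I * (r * t))) =
      Complex.exp (Complex.I * (r * t)) := by
    intro r
    rw [← Complex.exp_conj]
    simp
  rw [hrhs, phaseSum, map_sum, Finset.sum_mul_sum]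
  simp only [map_sum, map_mul, hconj, Finset.sum_mul, Finset.mul_sum]
  refine Finset.sum_congr rfl fun α _ => ?_
  refine Eq.trans ?_ (Finset.sum_congr rfl fun δ _ => Finset.sum_comm)
  rw [Finset.sum_comm]
  refine Finset.sum_congr rfl fun δ _ => Finset.sum_congr rfl fun γ _ =>
    Finset.sum_congr rfl fun β _ => ?_
  rw [mul_mul_mul_comm, ← Complex.exp_add]
  congr 2
  push_cast
  ring

lemma exists_tendsto_average_deviation (h : IsOrthogonalFamily p u) {E : ι → ℝ}
    (hE : ∀ α β : κ → ι, ∑ s, E (α s) = ∑ s, E (β s) → ∃ π : Equiv.Perm κ, β = α ∘ π)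
    (hE2 : ∀ α β : κ ⊕ κ → ι, ∑ s, E (α s) = ∑ s, E (β s) → ∃ π : Equiv.Perm (κ ⊕ κ), β = α ∘ π) :
    ∃ L ≤ deviationConst (Fintype.card κ) * (operatorNorm O ^ 2 * quarticSpread p u),
      Tendsto (fun T : ℝ => T⁻¹ * ∫ t in (0 : ℝ)..T,
        ‖phaseSum E (meanForm O p u) t - wickSum O p u‖ ^ 2) atTop (nhds L) := by
  refine ⟨_, re_deviation_le O h, ?_⟩
  set G := wickSum O p u with hG
  set f := phaseSum E (meanForm O p u) with hf
  have hfc : Continuous f := continuous_phaseSum _ _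
  have hpc : Continuous (phaseSum E (pairForm O p u)) := continuous_phaseSum _ _
  -- The two cross terms are conjugate, so under the real part they become `2 * conj G * f t`, and
  -- only the average of `f` itself is needed.
  have hpt : ∀ t, ‖f t - G‖ ^ 2 =
      (phaseSum E (pairForm O p u) t - 2 * conj G * f t + G * conj G).re := by
    intro t
    rw [← phaseSum_mul_conj, ← hf, ← Complex.normSq_eq_norm_sq, Complex.normSq_sub]
    simp [Complex.normSq_apply]
    ring
  have hlim := ((tendsto_average_phaseSum hE2 (pairForm O p u)).sub
    ((tendsto_average_phaseSum hE (meanForm O p u)).const_mul (2 * conj G))).add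
      (tendsto_const_nhds (x := G * conj G))
  have hre := (Complex.continuous_re.tendsto _).comp hlim
  have hval : (rearrangementSum (pairForm O p u) - 2 * conj G * rearrangementSum (meanForm O p u) +
      G * conj G).re = (rearrangementSum (pairForm O p u) -
        conj G * rearrangementSum (meanForm O p u) -
        G * conj (rearrangementSum (meanForm O p u)) + G * conj G).re := by
    simp
    ring
  rw [← hval]
  refine hre.congr' ?_
  filter_upwards [eventually_gt_atTop 0] with T hT
  have hT' : (T : ℂ) ≠ 0 := Complex.ofReal_ne_zero.2 hT.ne'
  have hi1 : IntervalIntegrable (phaseSum E (pairForm O p u)) volume 0 T :=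
    hpc.intervalIntegrable _ _
  have hi2 : IntervalIntegrable (fun t => 2 * conj G * f t) volume 0 T :=
    Continuous.intervalIntegrable (by fun_prop) _ _
  have hint : ∫ t in (0 : ℝ)..T, ‖f t - G‖ ^ 2 =
      (∫ t in (0 : ℝ)..T, (phaseSum E (pairForm O p u) t - 2 * conj G * f t + G * conj G)).re := by
    simp only [hpt]
    have hc : Continuous fun t => phaseSum E (pairForm O p u) t - 2 * conj G * f t + G * conj G := by
      fun_prop
    exact Complex.reCLM.intervalIntegral_comp_comm (hc.intervalIntegrable 0 T)
  rw [hint, intervalIntegral.integral_add (hi1.sub hi2) (by simp), intervalIntegral.integral_sub hi1 hi2,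
    intervalIntegral.integral_const_mul, intervalIntegral.integral_const]
  simp only [Function.comp_apply]
  rw [← Complex.re_ofReal_mul]
  congr 1
  push_cast
  rw [sub_zero, Complex.real_smul]
  field_simp
  rfl

end Deviation

/-! ### Words and their letter counts -/

section Words

variable {S ι : Type*} [Fintype S] [DecidableEq S] [DecidableEq ι]

omit [DecidableEq S] in
lemma exists_perm_of_card_fiber_eq {α β : S → ι}
    (h : ∀ m, (Finset.univ.filter fun s => α s = m).card = (Finset.univ.filter fun s => β s = m).card) :
    ∃ σ : Equiv.Perm S, β = α ∘ σ := by
  have e : ∀ m, Nonempty ({s // β s = m} ≃ {s // α s = m}) := by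
    intro m
    rw [← Fintype.card_eq, Fintype.card_subtype, Fintype.card_subtype]
    exact (h m).symm
  refine ⟨Equiv.ofFiberEquiv (f := β) (g := α) fun m => (e m).some, ?_⟩
  ext s
  exact (Equiv.ofFiberEquiv_map _ s).symm

omit [DecidableEq S] in
lemma card_fiber_comp_perm (α : S → ι) (σ : Equiv.Perm S) (m : ι) :
    (Finset.univ.filter fun s => (α ∘ σ) s = m).card = (Finset.univ.filter fun s => α s = m).card :=
  Finset.card_equiv σ (by simp)

/-- When nonempty, the set of such `σ` is a coset of the stabilizer of `α`. Written letter by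
letter, the count matches the moments `n!` of independent complex Gaussians. -/
lemma card_perm_comp_eq [Fintype ι] (α β : S → ι) :
    (Finset.univ.filter fun σ : Equiv.Perm S => α ∘ σ = β).card =
      ∏ m, if (Finset.univ.filter fun s => α s = m).card = (Finset.univ.filter fun s => β s = m).card
        then (Finset.univ.filter fun s => α s = m).card.factorial else 0 := by
  by_cases hex : ∃ τ : Equiv.Perm S, β = α ∘ τ
  · obtain ⟨τ, rfl⟩ := hex
    simp only [card_fiber_comp_perm, if_true]
    have h := DomMulAct.stabilizer_card α
    simp only [Fintype.card_subtype] at h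
    rw [← h]
    refine Finset.card_equiv (Equiv.mulRight τ⁻¹) fun σ => ?_
    simp only [Finset.mem_filter, Finset.mem_univ, true_and, Equiv.coe_mulRight, Equiv.Perm.coe_mul]
    constructor
    · intro hσ
      rw [← Function.comp_assoc, hσ]
      ext s
      simp
    · intro hσ
      rw [← Function.comp_assoc] at hσ
      ext s
      have := congrFun hσ (τ s)
      simpa using this
  · have hne : ∃ m, (Finset.univ.filter fun s => α s = m).card ≠
        (Finset.univ.filter fun s => β s = m).card := by
      by_contra! hc
      exact hex (exists_perm_of_card_fiber_eq hc)
    obtain ⟨m, hm⟩ := hne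
    rw [Finset.prod_eq_zero (Finset.mem_univ m) (if_neg hm), Finset.card_eq_zero,
      Finset.filter_eq_empty_iff]
    exact fun σ _ hσ => hex ⟨σ, hσ.symm⟩

omit [DecidableEq S] in
lemma prod_comp_eq_prod_pow [Fintype ι] {R : Type*} [CommMonoid R] (α : S → ι) (g : ι → R) :
    ∏ s, g (α s) = ∏ m, g m ^ (Finset.univ.filter fun s => α s = m).card := by
  rw [← Finset.prod_fiberwise' Finset.univ α g]
  simp only [Finset.prod_const]

end Words

/-! ### Moments of complex Gaussians -/

section Gaussian

lemma integral_norm_pow_mul_exp {v : ℝ} (hv : 0 < v) (n : ℕ) :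
    ∫ z : ℂ, ‖z‖ ^ n * Real.exp (-v⁻¹ * ‖z‖ ^ 2) =
      Real.pi * v⁻¹ ^ (-((n : ℝ) + 2) / 2) * Real.Gamma (((n : ℝ) + 2) / 2) := by
  have h := Complex.integral_rpow_mul_exp_neg_mul_rpow (p := 2) (q := n) (b := v⁻¹) (by norm_num)
    (by linarith [Nat.cast_nonneg (α := ℝ) n]) (inv_pos.2 hv)
  simp only [Real.rpow_natCast, Real.rpow_two] at h
  rw [h]
  ring

lemma integrable_norm_pow_mul_exp {v : ℝ} (hv : 0 < v) (n : ℕ) :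
    Integrable fun z : ℂ => ‖z‖ ^ n * Real.exp (-v⁻¹ * ‖z‖ ^ 2) := by
  -- A non-integrable function has integral zero by convention, so the explicit nonzero value proves
  -- integrability.
  refine Integrable.of_integral_ne_zero ?_
  rw [integral_norm_pow_mul_exp hv]
  have := Real.Gamma_pos_of_pos (s := ((n : ℝ) + 2) / 2) (by positivity)
  have := Real.pi_pos
  positivity

lemma integral_norm_pow_even_mul_exp {v : ℝ} (hv : 0 < v) (n : ℕ) :
    ∫ z : ℂ, ‖z‖ ^ (2 * n) * Real.exp (-v⁻¹ * ‖z‖ ^ 2) =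
      Real.pi * v ^ (n + 1) * n.factorial := by
  rw [integral_norm_pow_mul_exp hv]
  have h1 : (((2 * n : ℕ) : ℝ) + 2) / 2 = n + 1 := by push_cast; ring
  rw [neg_div, h1, Real.Gamma_nat_eq_factorial, Real.rpow_neg (inv_nonneg.2 hv.le),
    Real.inv_rpow hv.le, inv_inv]
  congr 2
  exact_mod_cast Real.rpow_natCast v (n + 1)

/-- The rotation by `π / (n - m)` preserves the Gaussian weight and changes the sign of `z ^ n *
conj z ^ m`. -/
lemma integral_pow_mul_conj_pow_mul_exp_of_ne {n m : ℕ} (hnm : n ≠ m) (w : ℝ) :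
    ∫ z : ℂ, (Real.exp (-w * ‖z‖ ^ 2) : ℂ) * (z ^ n * conj z ^ m) = 0 := by
  set θ : ℝ := Real.pi / ((n : ℝ) - m) with hθ
  have hne : (n : ℝ) - m ≠ 0 := sub_ne_zero.2 (Nat.cast_injective.ne hnm)
  set c : Circle := Circle.exp θ
  have hc : (c : ℂ) ^ n * conj (c : ℂ) ^ m = -1 := by
    have h1 : (c : ℂ) = Complex.exp (θ * Complex.I) := Circle.coe_exp θ
    have h2 : conj (c : ℂ) = Complex.exp (-(θ * Complex.I)) := by
      rw [h1, ← Complex.exp_conj]; simp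
    rw [h2, h1, ← Complex.exp_nat_mul, ← Complex.exp_nat_mul, ← Complex.exp_add,
      ← Complex.exp_pi_mul_I]
    congr 1
    have h3 : (Real.pi : ℂ) = ((n : ℂ) - m) * θ := by
      have : Real.pi = ((n : ℝ) - m) * θ := by rw [hθ]; field_simp
      exact_mod_cast congrArg (fun r : ℝ => (r : ℂ)) this
    rw [h3]; ring
  have h := (LinearIsometryEquiv.measurePreserving (rotation c)).integral_comp
    (rotation c).toHomeomorph.measurableEmbedding
    (fun z : ℂ => (Real.exp (-w * ‖z‖ ^ 2) : ℂ) * (z ^ n * conj z ^ m))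
  have h2 : ∀ z : ℂ, (Real.exp (-w * ‖rotation c z‖ ^ 2) : ℂ) *
      (rotation c z ^ n * conj (rotation c z) ^ m) =
      -((Real.exp (-w * ‖z‖ ^ 2) : ℂ) * (z ^ n * conj z ^ m)) := by
    intro z
    rw [LinearIsometryEquiv.norm_map, rotation_apply, map_mul, mul_pow, mul_pow]
    linear_combination (Real.exp (-w * ‖z‖ ^ 2) : ℂ) * (z ^ n * conj z ^ m) * hc
  simp only [h2, integral_neg] at h
  exact CharZero.eq_neg_self_iff.1 h.symm

lemma complexGaussian_of_pos {v : ℝ} (hv : 0 < v) :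
    complexGaussian v = volume.withDensity fun z =>
      ENNReal.ofReal ((v * Real.pi)⁻¹ * Real.exp (-v⁻¹ * ‖z‖ ^ 2)) :=
  if_neg hv.ne'

lemma density_nonneg {v : ℝ} (hv : 0 < v) (z : ℂ) :
    0 ≤ (v * Real.pi)⁻¹ * Real.exp (-v⁻¹ * ‖z‖ ^ 2) := by
  have := Real.pi_pos
  positivity

lemma measurable_density (v : ℝ) : Measurable fun z : ℂ =>
    ENNReal.ofReal ((v * Real.pi)⁻¹ * Real.exp (-v⁻¹ * ‖z‖ ^ 2)) := by
  fun_prop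

lemma isFiniteMeasure_complexGaussian {v : ℝ} (hv : 0 ≤ v) : IsFiniteMeasure (complexGaussian v) := by
  rcases hv.eq_or_lt with rfl | hv
  · rw [complexGaussian, if_pos rfl]
    infer_instance
  · rw [complexGaussian_of_pos hv]
    refine isFiniteMeasure_withDensity_ofReal ?_
    have := (integrable_norm_pow_mul_exp hv 0).const_mul (v * Real.pi)⁻¹
    simpa using this.2

lemma integrable_pow_mul_conj_pow {v : ℝ} (hv : 0 ≤ v) (n m : ℕ) :
    Integrable (fun z : ℂ => z ^ n * conj z ^ m) (complexGaussian v) := by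
  rcases hv.eq_or_lt with rfl | hv
  · rw [complexGaussian, if_pos rfl]
    exact integrable_dirac (enorm_lt_top (x := (0 : ℂ) ^ n * conj (0 : ℂ) ^ m))
  · rw [complexGaussian_of_pos hv, integrable_withDensity_iff_integrable_smul' (measurable_density v)
      (.of_forall fun _ => ENNReal.ofReal_lt_top)]
    have h := (integrable_norm_pow_mul_exp hv (n + m)).const_mul (v * Real.pi)⁻¹
    refine h.mono' ?_ (.of_forall fun z => ?_)
    · have h1 : AEStronglyMeasurable (fun z : ℂ => (ENNReal.ofReal ((v * Real.pi)⁻¹ *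
          Real.exp (-v⁻¹ * ‖z‖ ^ 2))).toReal) volume :=
        (measurable_density v).ennreal_toReal.aestronglyMeasurable
      have h2 : AEStronglyMeasurable (fun z : ℂ => z ^ n * conj z ^ m) volume :=
        Continuous.aestronglyMeasurable (by fun_prop)
      exact h1.smul h2
    · rw [ENNReal.toReal_ofReal (density_nonneg hv z), norm_smul,
        Real.norm_of_nonneg (density_nonneg hv z), norm_mul, norm_pow, norm_pow, RCLike.norm_conj,
        pow_add]
      exact le_of_eq (by ring)

lemma integral_pow_mul_conj_pow {v : ℝ} (hv : 0 ≤ v) (n m : ℕ) :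
    ∫ z, z ^ n * conj z ^ m ∂(complexGaussian v) =
      if n = m then (n.factorial : ℂ) * (v : ℂ) ^ n else 0 := by
  rcases hv.eq_or_lt with rfl | hv
  · rw [complexGaussian, if_pos rfl, integral_dirac]
    split_ifs with h
    · subst h
      rcases n with _ | n <;> simp
    · rcases n with _ | n
      · rcases m with _ | m
        · exact absurd rfl h
        · simp
      · simp
  · rw [complexGaussian_of_pos hv, integral_withDensity_eq_integral_toReal_smul (measurable_density v)
      (.of_forall fun _ => ENNReal.ofReal_lt_top)]
    have h1 : ∀ z : ℂ, (ENNReal.ofReal ((v * Real.pi)⁻¹ * Real.exp (-v⁻¹ * ‖z‖ ^ 2))).toReal •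
        (z ^ n * conj z ^ m) = ((v * Real.pi)⁻¹ : ℝ) *
          ((Real.exp (-v⁻¹ * ‖z‖ ^ 2) : ℂ) * (z ^ n * conj z ^ m)) := by
      intro z
      rw [ENNReal.toReal_ofReal (density_nonneg hv z), Complex.real_smul]
      push_cast; ring
    simp only [h1]
    rw [integral_const_mul]
    split_ifs with h
    · subst h
      have h2 : ∀ z : ℂ, (Real.exp (-v⁻¹ * ‖z‖ ^ 2) : ℂ) * (z ^ n * conj z ^ n) =
          ((‖z‖ ^ (2 * n) * Real.exp (-v⁻¹ * ‖z‖ ^ 2) : ℝ) : ℂ) := by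
        intro z
        rw [← mul_pow, Complex.mul_conj']
        push_cast
        rw [← pow_mul]; ring
      simp only [h2]
      rw [integral_complex_ofReal, integral_norm_pow_even_mul_exp hv]
      have hv' : (v : ℂ) ≠ 0 := Complex.ofReal_ne_zero.2 hv.ne'
      have hpi : (Real.pi : ℂ) ≠ 0 := Complex.ofReal_ne_zero.2 Real.pi_ne_zero
      push_cast
      field_simp
      ring
    · rw [integral_pow_mul_conj_pow_mul_exp_of_ne h, mul_zero]

end Gaussian

/-! ### Wick's formula for the Scrooge ensemble -/

section Wick

variable {A : Type*} [Fintype A] [DecidableEq A] {S : Type*} [Fintype S] [DecidableEq S]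

omit [DecidableEq S] in
lemma monomial_eq_prod (α β : S → A) (g : A → ℂ) :
    (∏ i, g (α i)) * ∏ i, conj (g (β i)) =
      ∏ m, (g m ^ (Finset.univ.filter fun s => α s = m).card *
        conj (g m) ^ (Finset.univ.filter fun s => β s = m).card) := by
  rw [prod_comp_eq_prod_pow α g, prod_comp_eq_prod_pow β fun m => conj (g m),
    Finset.prod_mul_distrib]

omit [DecidableEq S] in
lemma integrable_monomial {v : A → ℝ} (hv : ∀ m, 0 ≤ v m) (α β : S → A) :
    Integrable (fun g : A → ℂ => (∏ i, g (α i)) * ∏ i, conj (g (β i)))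
      (Measure.pi fun m => complexGaussian (v m)) := by
  have := fun m => isFiniteMeasure_complexGaussian (hv m)
  simp only [monomial_eq_prod]
  exact Integrable.fintype_prod fun m => integrable_pow_mul_conj_pow (hv m) _ _

lemma integral_monomial {v : A → ℝ} (hv : ∀ m, 0 ≤ v m) (α β : S → A) :
    ∫ g : A → ℂ, (∏ i, g (α i)) * ∏ i, conj (g (β i)) ∂(Measure.pi fun m => complexGaussian (v m)) =
      ∑ σ : Equiv.Perm S, if α ∘ σ = β then ∏ i, (v (α i) : ℂ) else 0 := by
  have := fun m => isFiniteMeasure_complexGaussian (hv m)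
  simp only [monomial_eq_prod]
  rw [integral_fintype_prod_eq_prod (f := fun m z =>
    z ^ (Finset.univ.filter fun s => α s = m).card *
        conj z ^ (Finset.univ.filter fun s => β s = m).card)]
  simp only [integral_pow_mul_conj_pow (hv _)]
  rw [← Finset.sum_filter, Finset.sum_const, card_perm_comp_eq,
    prod_comp_eq_prod_pow α fun m => (v m : ℂ), nsmul_eq_mul,
    Nat.cast_prod, ← Finset.prod_mul_distrib]
  refine Finset.prod_congr rfl fun m _ => ?_
  split_ifs <;> simp

lemma eq_sum_eigenvalues {ρ : Matrix A A ℂ} (hρ : ρ.IsHermitian) (a b : A) :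
    ρ a b = ∑ m, (hρ.eigenvalues m : ℂ) * ((hρ.eigenvectorUnitary : Matrix A A ℂ) a m *
      conj ((hρ.eigenvectorUnitary : Matrix A A ℂ) b m)) := by
  conv_lhs => rw [hρ.spectral_theorem]
  simp [Unitary.conjStarAlgAut_apply, Matrix.mul_apply, Matrix.diagonal_apply, Matrix.star_apply]
  refine Finset.sum_congr rfl fun m _ => ?_
  ring

/-- Wick's formula. -/
lemma scroogeMoment_apply (k : ℕ) (ρ : Matrix A A ℂ) (hρ : ρ.PosSemidef) (a b : Fin k → A) :
    scroogeMoment k ρ hρ a b = ∑ σ : Equiv.Perm (Fin k), ∏ i, ρ (a i) (b (σ i)) := by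
  set U : Matrix A A ℂ := (hρ.isHermitian.eigenvectorUnitary : Matrix A A ℂ) with hU
  set v := hρ.isHermitian.eigenvalues with hv
  have hv0 : ∀ m, 0 ≤ v m := hρ.eigenvalues_nonneg
  have hUc : Continuous fun g : A → ℂ => U *ᵥ g := Continuous.matrix_mulVec continuous_const continuous_id
  have hkc : Continuous fun ψ : A → ℂ => ketbraPow k ψ a b := by
    unfold ketbraPow
    exact continuous_finsetProd _ fun i _ =>
      (continuous_apply _).mul (Complex.continuous_conj.comp (continuous_apply _))
  have hexp : ∀ g : A → ℂ, ketbraPow k (U *ᵥ g) a b =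
      ∑ α : Fin k → A, ∑ β : Fin k → A, ((∏ i, U (a i) (α i)) * ∏ i, conj (U (b i) (β i))) *
        ((∏ i, g (α i)) * ∏ i, conj (g (β i))) := by
    intro g
    simp only [ketbraPow, Finset.prod_mul_distrib, mulVec, dotProduct, map_sum, map_mul,
      Finset.prod_univ_sum, Fintype.piFinset_univ, Finset.sum_mul_sum]
    refine Finset.sum_congr rfl fun α _ => Finset.sum_congr rfl fun β _ => ?_
    ring
  have hint := fun α β : Fin k → A => integrable_monomial hv0 α β
  unfold scroogeMoment scrooge
  rw [integral_map hUc.aemeasurable hkc.aestronglyMeasurable]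
  simp only [← hv, hexp]
  rw [integral_finsetSum _ fun α _ => integrable_finsetSum _ fun β _ => (hint α β).const_mul _]
  have hinner : ∀ α : Fin k → A, ∫ g : A → ℂ, ∑ β : Fin k → A,
      ((∏ i, U (a i) (α i)) * ∏ i, conj (U (b i) (β i))) *
        ((∏ i, g (α i)) * ∏ i, conj (g (β i))) ∂(Measure.pi fun m => complexGaussian (v m)) =
      ∑ σ : Equiv.Perm (Fin k), ∏ i, ((v (α i) : ℂ) * (U (a i) (α i) *
        conj (U (b (σ i)) (α i)))) := by
    intro α
    rw [integral_finsetSum _ fun β _ => (hint α β).const_mul _]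
    simp only [integral_const_mul, integral_monomial hv0, Finset.mul_sum, mul_ite, mul_zero]
    -- The monomials force `β = α ∘ σ`. Summing over `σ⁻¹` instead puts the permutation on the index
    -- `b` after the product is reordered.
    rw [Finset.sum_comm, ← Equiv.sum_comp (Equiv.inv (Equiv.Perm (Fin k)))]
    refine Finset.sum_congr rfl fun σ _ => ?_
    rw [Finset.sum_ite_eq Finset.univ]
    simp only [Finset.mem_univ, if_true, Finset.prod_mul_distrib, Function.comp_apply]
    rw [← Equiv.prod_comp σ fun i => conj (U (b i) (α ((Equiv.inv (Equiv.Perm (Fin k))) σ i)))]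
    simp
    ring
  simp only [hinner]
  rw [Finset.sum_comm]
  refine Finset.sum_congr rfl fun σ _ => ?_
  simp only [eq_sum_eigenvalues hρ.isHermitian]
  rw [Finset.prod_univ_sum, Fintype.piFinset_univ]

end Wick

/-! ### Energy components of the state -/

section Energy

variable {n : Type*} [Fintype n] [DecidableEq n] {H : Matrix n n ℂ} (hH : H.IsHermitian)
  (ψ : EuclideanSpace ℂ n)

lemma energyComponent_eq (E : ℝ) :
    energyComponent hH ψ E = (∑ i with hH.eigenvalues i = E,
      inner ℂ (hH.eigenvectorBasis i) ψ • hH.eigenvectorBasis i : EuclideanSpace ℂ n).ofLp := by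
  ext a
  simp [energyComponent, Finset.sum_apply]

lemma energyComponent_orthogonal {E F : ℝ} (hEF : E ≠ F) :
    star (energyComponent hH ψ E) ⬝ᵥ energyComponent hH ψ F = 0 := by
  rw [energyComponent_eq, energyComponent_eq, dotProduct_comm,
    ← EuclideanSpace.inner_eq_star_dotProduct, sum_inner]
  refine Finset.sum_eq_zero fun i hi => ?_
  rw [inner_sum]
  refine Finset.sum_eq_zero fun j hj => ?_
  rw [inner_smul_left, inner_smul_right, orthonormal_iff_ite.1 hH.eigenvectorBasis.orthonormal, if_neg]
  · simp
  · rintro rfl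
    exact hEF ((Finset.mem_filter.1 hi).2.symm.trans (Finset.mem_filter.1 hj).2)

lemma sum_energies_fiber {R : Type*} [AddCommMonoid R] (g : ℝ → n → R) :
    ∑ e : energies hH, ∑ i with hH.eigenvalues i = (e : ℝ), g e i = ∑ i, g (hH.eigenvalues i) i := by
  rw [Finset.sum_coe_sort (energies hH) fun e => ∑ i with hH.eigenvalues i = e, g e i]
  rw [← Finset.sum_fiberwise_of_maps_to (s := Finset.univ) (t := energies hH)
    (g := hH.eigenvalues) (fun i _ => Finset.mem_image_of_mem _ (Finset.mem_univ i))]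
  refine Finset.sum_congr rfl fun e _ => Finset.sum_congr rfl fun i hi => ?_
  rw [(Finset.mem_filter.1 hi).2]

lemma sum_energyComponent : ∑ e : energies hH, energyComponent hH ψ e = ψ.ofLp := by
  ext a
  rw [Finset.sum_apply]
  unfold energyComponent
  rw [sum_energies_fiber hH fun _ i => inner ℂ (hH.eigenvectorBasis i) ψ * hH.eigenvectorBasis i a]
  have h := congrArg (fun v : EuclideanSpace ℂ n => v.ofLp a) (hH.eigenvectorBasis.sum_repr' ψ)
  simpa [Finset.sum_apply] using h

lemma sum_sqNorm_energyComponent :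
    ∑ e : energies hH, sqNorm (energyComponent hH ψ e) = ‖ψ‖ ^ 2 := by
  have h : (((∑ e : energies hH, sqNorm (energyComponent hH ψ e) : ℝ)) : ℂ) = (sqNorm ψ.ofLp : ℂ) := by
    rw [← star_dotProduct_self ψ.ofLp, ← sum_energyComponent hH ψ, star_sum, sum_dotProduct,
      Complex.ofReal_sum]
    refine Finset.sum_congr rfl fun e _ => ?_
    rw [dotProduct_sum, Finset.sum_eq_single e, star_dotProduct_self]
    · intro f _ hfe
      exact energyComponent_orthogonal hH ψ fun hEF => hfe (Subtype.ext hEF.symm)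
    · simp
  rw [← norm_toLp_sq] at h
  exact_mod_cast h

lemma evolve_eq (t : ℝ) : evolve H ψ t =
    fun a => ∑ e : energies hH, Complex.exp (-Complex.I * (((e : ℝ) : ℂ) * t)) *
      energyComponent hH ψ e a := by
  set U : Matrix n n ℂ := (hH.eigenvectorUnitary : Matrix n n ℂ) with hU
  let V : (Matrix n n ℂ)ˣ := ⟨U, star U, Unitary.mul_star_self_of_mem hH.eigenvectorUnitary.2,
    Unitary.star_mul_self_of_mem hH.eigenvectorUnitary.2⟩
  have h1 : (-Complex.I * (t : ℂ)) • H =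
      V * diagonal (fun i => -Complex.I * ((hH.eigenvalues i : ℂ) * t)) * (V⁻¹ : (Matrix n n ℂ)ˣ) := by
    conv_lhs => rw [hH.spectral_theorem, Unitary.conjStarAlgAut_apply]
    rw [← Matrix.smul_mul, ← Matrix.mul_smul, ← Matrix.diagonal_smul]
    congr 3
    ext1 i
    simp only [Pi.smul_apply, Function.comp_apply, smul_eq_mul]
    simp only [RCLike.ofReal_eq_complex_ofReal]
    ring
  ext a
  unfold evolve
  rw [h1, Matrix.exp_units_conj, Matrix.exp_diagonal]
  have h2 : ((V : Matrix n n ℂ) * diagonal (NormedSpace.exp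
      (fun i => -Complex.I * ((hH.eigenvalues i : ℂ) * t))) * ((V⁻¹ : (Matrix n n ℂ)ˣ) : Matrix n n ℂ))
      *ᵥ ψ.ofLp = U *ᵥ (diagonal (NormedSpace.exp
      (fun i => -Complex.I * ((hH.eigenvalues i : ℂ) * t))) *ᵥ (star U *ᵥ ψ.ofLp)) := by
    rw [Matrix.mulVec_mulVec, Matrix.mulVec_mulVec]
    rfl
  rw [h2]
  unfold energyComponent
  simp only [Finset.mul_sum]
  rw [sum_energies_fiber hH fun E i => Complex.exp (-Complex.I * ((E : ℂ) * t)) *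
    (inner ℂ (hH.eigenvectorBasis i) ψ * hH.eigenvectorBasis i a)]
  rw [Matrix.mulVec, dotProduct]
  refine Finset.sum_congr rfl fun i _ => ?_
  rw [Matrix.mulVec_diagonal]
  have h3 : (star U *ᵥ ψ.ofLp) i = inner ℂ (hH.eigenvectorBasis i) ψ := by
    rw [EuclideanSpace.inner_eq_star_dotProduct, dotProduct_comm]
    simp only [Matrix.mulVec, dotProduct, Matrix.star_apply, hU, hH.eigenvectorUnitary_apply]
    rfl
  rw [h3, hU, hH.eigenvectorUnitary_apply, Pi.coe_exp, ← Complex.exp_eq_exp_ℂ]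
  ring

end Energy

/-! ### Projected energy components -/

section Projection

variable {A B X : Type*} [Fintype A] [DecidableEq A] [Fintype B] [DecidableEq B] [Fintype X]
  {H : Matrix (A × B) (A × B) ℂ}

omit [Fintype A] [DecidableEq A] [DecidableEq B] in
lemma projectOperator_ketbra (x : EuclideanSpace ℂ B) (v : A × B → ℂ) :
    projectOperator x (ketbra v) = ketbra (projectState x v) := by
  ext a a'
  simp only [projectOperator, ketbra, vecMulVec_apply, projectState, Pi.star_apply, star_sum,
    Finset.sum_mul_sum, RCLike.star_def, map_mul, Complex.conj_conj]
  refine Finset.sum_congr rfl fun b _ => Finset.sum_congr rfl fun b' _ => ?_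
  ring

lemma projectOperator_diagonalEnsemble (hH : H.IsHermitian) (Ψ₀ : EuclideanSpace ℂ (A × B))
    (x : EuclideanSpace ℂ B) :
    projectOperator x (diagonalEnsemble hH Ψ₀) =
      ∑ e : energies hH, ketbra (projectState x (energyComponent hH Ψ₀ e)) := by
  simp only [← projectOperator_ketbra]
  rw [Finset.sum_coe_sort (energies hH) fun e => projectOperator x (ketbra (energyComponent hH Ψ₀ e))]
  ext a a'
  simp only [projectOperator, diagonalEnsemble, Matrix.sum_apply, Finset.mul_sum, Finset.sum_mul]
  rw [Finset.sum_congr rfl fun b _ => Finset.sum_comm, Finset.sum_comm]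

lemma trace_ketbra {ι : Type*} [Fintype ι] (v : ι → ℂ) : (ketbra v).trace = (sqNorm v : ℂ) := by
  rw [ketbra, trace_vecMulVec, dotProduct_comm, star_dotProduct_self]

lemma pd_eq (hH : H.IsHermitian) (Ψ₀ : EuclideanSpace ℂ (A × B)) (x : EuclideanSpace ℂ B) :
    pd hH Ψ₀ x = ∑ e : energies hH, sqNorm (projectState x (energyComponent hH Ψ₀ e)) := by
  rw [pd, projectOperator_diagonalEnsemble, Matrix.trace_sum]
  simp only [trace_ketbra, ← Complex.ofReal_sum, Complex.ofReal_re]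

omit [DecidableEq A] [DecidableEq B] in
lemma sum_projectState (x : OrthonormalBasis X ℂ (EuclideanSpace ℂ B)) (v w : A × B → ℂ) :
    ∑ j, star (projectState (x j) v) ⬝ᵥ projectState (x j) w = star v ⬝ᵥ w := by
  have hproj : ∀ (v : A × B → ℂ) j a, projectState (x j) v a =
      inner ℂ (x j) (WithLp.toLp 2 fun b => v (a, b)) := by
    intro v j a
    rw [EuclideanSpace.inner_eq_star_dotProduct, dotProduct_comm]
    rfl
  simp only [dotProduct, Fintype.sum_prod_type]
  rw [Finset.sum_comm]
  refine Finset.sum_congr rfl fun a _ => ?_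
  simp only [Pi.star_apply, hproj, RCLike.star_def, inner_conj_symm]
  rw [x.sum_inner_mul_inner, EuclideanSpace.inner_eq_star_dotProduct, dotProduct_comm]
  rfl

lemma sum_pd (hH : H.IsHermitian) {Ψ₀ : EuclideanSpace ℂ (A × B)} (hΨ : ‖Ψ₀‖ = 1)
    (x : OrthonormalBasis X ℂ (EuclideanSpace ℂ B)) : ∑ j, pd hH Ψ₀ (x j) = 1 := by
  have h := sum_sqNorm_energyComponent hH Ψ₀
  rw [hΨ, one_pow] at h
  rw [← h]
  simp only [pd_eq]
  rw [Finset.sum_comm]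
  refine Finset.sum_congr rfl fun e _ => ?_
  have := sum_projectState x (energyComponent hH Ψ₀ e) (energyComponent hH Ψ₀ e)
  simp only [star_dotProduct_self] at this
  exact_mod_cast this

lemma pd_nonneg (hH : H.IsHermitian) (Ψ₀ : EuclideanSpace ℂ (A × B)) (x : EuclideanSpace ℂ B) :
    0 ≤ pd hH Ψ₀ x := by
  rw [pd_eq]
  exact Finset.sum_nonneg fun _ _ => sqNorm_nonneg _

/-- The projected energy components, in units of `√(p_d)`. -/
noncomputable def scaledComponent (hH : H.IsHermitian) (Ψ₀ : EuclideanSpace ℂ (A × B))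
    (x : EuclideanSpace ℂ B) (e : energies hH) : A → ℂ :=
  (((√(pd hH Ψ₀ x))⁻¹ : ℝ) : ℂ) • projectState x (energyComponent hH Ψ₀ e)

omit [DecidableEq A] in
lemma sqNorm_smul (c : ℝ) (v : A → ℂ) : sqNorm ((c : ℂ) • v) = c ^ 2 * sqNorm v := by
  simp [sqNorm, mul_pow, Finset.mul_sum]

lemma sqNorm_scaledComponent (hH : H.IsHermitian) (Ψ₀ : EuclideanSpace ℂ (A × B))
    (x : EuclideanSpace ℂ B) (e : energies hH) : sqNorm (scaledComponent hH Ψ₀ x e) =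
      (pd hH Ψ₀ x)⁻¹ * sqNorm (projectState x (energyComponent hH Ψ₀ e)) := by
  rw [scaledComponent, sqNorm_smul, inv_pow, Real.sq_sqrt (pd_nonneg _ _ _)]

lemma projectState_eq_zero {hH : H.IsHermitian} {Ψ₀ : EuclideanSpace ℂ (A × B)}
    {x : EuclideanSpace ℂ B} (h : pd hH Ψ₀ x = 0) (e : energies hH) :
    projectState x (energyComponent hH Ψ₀ e) = 0 := by
  rw [pd_eq, Finset.sum_eq_zero_iff_of_nonneg fun _ _ => sqNorm_nonneg _] at h
  have h1 := h e (Finset.mem_univ e)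
  rw [sqNorm, Finset.sum_eq_zero_iff_of_nonneg fun _ _ => sq_nonneg _] at h1
  ext a
  simpa using h1 a (Finset.mem_univ a)

/-- The weight `p_d` cancels the normalization, and completeness of the measurement basis restores
the inner product of the full energy components. -/
lemma isOrthogonalFamily_scaledComponent (hH : H.IsHermitian) {Ψ₀ : EuclideanSpace ℂ (A × B)}
    (hΨ : ‖Ψ₀‖ = 1) (x : OrthonormalBasis X ℂ (EuclideanSpace ℂ B)) :
    IsOrthogonalFamily (fun j => pd hH Ψ₀ (x j)) (fun j => scaledComponent hH Ψ₀ (x j)) where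
  nonneg j := pd_nonneg _ _ _
  sum_weight := sum_pd hH hΨ x
  sum_sqNorm_le j := by
    simp only [sqNorm_scaledComponent]
    rw [← Finset.mul_sum, ← pd_eq]
    -- The value is one, except for impossible outcomes, where it is zero.
    exact inv_mul_le_one
  orthogonal e f hef := by
    have h : ∀ j, ((pd hH Ψ₀ (x j) : ℝ) : ℂ) *
        (star (scaledComponent hH Ψ₀ (x j) e) ⬝ᵥ scaledComponent hH Ψ₀ (x j) f) =
        star (projectState (x j) (energyComponent hH Ψ₀ e)) ⬝ᵥ
          projectState (x j) (energyComponent hH Ψ₀ f) := by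
      intro j
      by_cases h0 : pd hH Ψ₀ (x j) = 0
      · simp [projectState_eq_zero h0, h0]
      · rw [scaledComponent, scaledComponent, star_smul, smul_dotProduct, dotProduct_smul,
          RCLike.star_def, Complex.conj_ofReal, smul_eq_mul, smul_eq_mul, ← mul_assoc, ← mul_assoc,
          ← Complex.ofReal_mul, ← Complex.ofReal_mul, mul_assoc, ← sq, inv_pow,
          Real.sq_sqrt (pd_nonneg _ _ _), mul_inv_cancel₀ h0, Complex.ofReal_one, one_mul]
    simp only [h, sum_projectState]
    exact energyComponent_orthogonal hH Ψ₀ fun h => hef (Subtype.ext h)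

omit [DecidableEq B] in
lemma trace_projection_mul_ketbra (x : EuclideanSpace ℂ B) (v : A × B → ℂ) :
    (((1 : Matrix A A ℂ) ⊗ₖ ketbra x.ofLp) * ketbra v).trace = (sqNorm (projectState x v) : ℂ) := by
  rw [← star_dotProduct_self]
  simp only [Matrix.trace, Matrix.diag, Matrix.mul_apply, Fintype.sum_prod_type, kroneckerMap_apply,
    ketbra, vecMulVec_apply, Matrix.one_apply, dotProduct, projectState, Pi.star_apply, star_sum,
    Finset.sum_mul_sum]
  refine Finset.sum_congr rfl fun a _ => Finset.sum_congr rfl fun b _ => ?_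
  rw [Finset.sum_eq_single a]
  · refine Finset.sum_congr rfl fun b' _ => ?_
    simp only [if_true, RCLike.star_def, map_mul, Complex.conj_conj]
    ring
  · intro c _ hc
    simp [hc.symm]
  · simp

lemma deltaBeta_eq (hH : H.IsHermitian) (Ψ₀ : EuclideanSpace ℂ (A × B))
    (x : OrthonormalBasis X ℂ (EuclideanSpace ℂ B)) :
    deltaBeta hH Ψ₀ x =
      quarticSpread (fun j => pd hH Ψ₀ (x j)) (fun j => scaledComponent hH Ψ₀ (x j)) := by
  unfold deltaBeta quarticSpread
  refine Finset.sum_congr rfl fun j _ => ?_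
  congr 1
  unfold deltaOutcome diagonalEnsemble₂
  rw [Finset.mul_sum, Matrix.trace_sum]
  simp only [← Matrix.mul_kronecker_mul, Matrix.trace_kronecker, trace_projection_mul_ketbra,
    sqNorm_scaledComponent]
  rw [← Finset.sum_coe_sort (energies hH)]
  simp only [← Complex.ofReal_mul, ← Complex.ofReal_sum, Complex.ofReal_re]
  rw [Finset.sum_div]
  refine Finset.sum_congr rfl fun e _ => ?_
  rw [mul_pow, inv_pow]
  ring

end Projection

/-! ### Moments as random-phase forms -/

section Moments

variable {A B X : Type*} [Fintype A] [DecidableEq A] [Fintype B] [DecidableEq B] [Fintype X]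
  {H : Matrix (A × B) (A × B) ℂ} {k : ℕ}

omit [DecidableEq A] in
lemma trace_mul_ketbraPow (O : Matrix (Fin k → A) (Fin k → A) ℂ) (ψ : A → ℂ) :
    (O * ketbraPow k ψ).trace = tensorForm O (fun _ => ψ) (fun _ => ψ) := by
  simp only [Matrix.trace, Matrix.diag, Matrix.mul_apply, ketbraPow, tensorForm,
    Finset.prod_mul_distrib, map_prod, mul_assoc]

omit [DecidableEq A] in
lemma tensorForm_smul (O : Matrix (Fin k → A) (Fin k → A) ℂ) (c : ℝ) (ψ : A → ℂ) :
    tensorForm O (fun _ => (c : ℂ) • ψ) (fun _ => (c : ℂ) • ψ) =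
      ((c ^ 2) ^ k : ℝ) * tensorForm O (fun _ => ψ) (fun _ => ψ) := by
  simp only [tensorForm, Finset.mul_sum, Pi.smul_apply, smul_eq_mul, Finset.prod_mul_distrib,
    Finset.prod_const, Finset.card_univ, Fintype.card_fin, map_mul, map_pow, Complex.conj_ofReal]
  refine Finset.sum_congr rfl fun b _ => Finset.sum_congr rfl fun a _ => ?_
  push_cast
  ring

lemma trace_mul_projectedMoment (hk : 1 ≤ k) (hH : H.IsHermitian) (Ψ₀ : EuclideanSpace ℂ (A × B))
    (x : OrthonormalBasis X ℂ (EuclideanSpace ℂ B)) (O : Matrix (Fin k → A) (Fin k → A) ℂ) (t : ℝ) :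
    (O * projectedMoment k hH Ψ₀ x t).trace =
      phaseSum (fun e : energies hH => (e : ℝ)) (meanForm O (fun j => pd hH Ψ₀ (x j))
        fun j => scaledComponent hH Ψ₀ (x j)) t := by
  rw [← sum_tensorForm_evolved, projectedMoment, Finset.mul_sum, Matrix.trace_sum]
  refine Finset.sum_congr rfl fun j _ => ?_
  rw [Matrix.mul_smul, Matrix.trace_smul, trace_mul_ketbraPow]
  have hψ : projectState (x j) (evolve H Ψ₀ t) = fun a => ∑ e : energies hH,
      Complex.exp (-Complex.I * (((e : ℝ) : ℂ) * t)) *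
        projectState (x j) (energyComponent hH Ψ₀ e) a := by
    ext a
    rw [evolve_eq hH]
    simp only [projectState, Finset.mul_sum]
    rw [Finset.sum_comm]
    refine Finset.sum_congr rfl fun e _ => Finset.sum_congr rfl fun b _ => ?_
    ring
  have hscaled : (fun a => ∑ e : energies hH, Complex.exp (-Complex.I * (((e : ℝ) : ℂ) * t)) *
      scaledComponent hH Ψ₀ (x j) e a) =
      (((√(pd hH Ψ₀ (x j)))⁻¹ : ℝ) : ℂ) • projectState (x j) (evolve H Ψ₀ t) := by
    rw [hψ]
    ext a
    simp only [scaledComponent, Pi.smul_apply, smul_eq_mul, Finset.mul_sum]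
    refine Finset.sum_congr rfl fun e _ => ?_
    ring
  rw [hscaled, tensorForm_smul, inv_pow, Real.sq_sqrt (pd_nonneg _ _ _), Complex.real_smul,
    ← mul_assoc, ← Complex.ofReal_mul]
  -- For `k = 1` the weight of an impossible outcome is `(0 ^ 0)⁻¹ = 1`. The term still vanishes,
  -- because the projected state is zero and `k ≥ 1`.
  by_cases h0 : pd hH Ψ₀ (x j) = 0
  · have hz : projectState (x j) (evolve H Ψ₀ t) = 0 := by
      rw [hψ]
      ext a
      simp [projectState_eq_zero h0]
    have hzero : tensorForm O (fun _ : Fin k => (0 : A → ℂ)) (fun _ => 0) = 0 := by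
      simp [tensorForm, Nat.ne_of_gt hk]
    rw [hz, hzero, mul_zero, mul_zero]
  · congr 2
    -- The weight `p_d^{-(k-1)}` is the probability `p_d` times the factor `p_d^{-k}` that
    -- normalizes the `k` copies.
    obtain ⟨k, rfl⟩ := Nat.exists_eq_add_of_le' hk
    rw [Nat.add_sub_cancel, inv_pow, pow_succ]
    field_simp

lemma rhoBar_eq (hH : H.IsHermitian) (Ψ₀ : EuclideanSpace ℂ (A × B)) (x : EuclideanSpace ℂ B)
    (a b : A) : rhoBar hH Ψ₀ x a b =
      ∑ e : energies hH, scaledComponent hH Ψ₀ x e a * conj (scaledComponent hH Ψ₀ x e b) := by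
  rw [rhoBar, projectOperator_diagonalEnsemble, Matrix.smul_apply, Matrix.sum_apply, Finset.smul_sum]
  refine Finset.sum_congr rfl fun e _ => ?_
  simp only [ketbra, vecMulVec_apply, scaledComponent, Pi.smul_apply, Pi.star_apply, smul_eq_mul,
    map_mul, Complex.conj_ofReal, Complex.real_smul]
  rw [mul_mul_mul_comm, ← Complex.ofReal_mul, ← mul_inv, Real.mul_self_sqrt (pd_nonneg _ _ _)]
  rfl

/-- Wick's formula depends on `ρ` only, so any decomposition into rank-one terms may be used. The
energy components, generally not orthogonal after projection, serve as well as the eigenvectors. -/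
lemma trace_mul_scroogeMoment {ι : Type*} [Fintype ι] (O : Matrix (Fin k → A) (Fin k → A) ℂ)
    {ρ : Matrix A A ℂ} (hρ : ρ.PosSemidef) (u : ι → A → ℂ)
    (hu : ∀ a b, ρ a b = ∑ e, u e a * conj (u e b)) :
    (O * scroogeMoment k ρ hρ).trace = ∑ σ : Equiv.Perm (Fin k), ∑ α : Fin k → ι,
      tensorForm O (fun i => u (α i)) (fun i => u ((α ∘ σ) i)) := by
  simp only [Matrix.trace, Matrix.diag, Matrix.mul_apply, scroogeMoment_apply, hu,
    Finset.prod_univ_sum, Fintype.piFinset_univ, Finset.mul_sum, tensorForm]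
  rw [← Equiv.sum_comp (Equiv.inv (Equiv.Perm (Fin k)))]
  rw [Finset.sum_congr rfl fun b _ => Finset.sum_comm, Finset.sum_comm]
  refine Finset.sum_congr rfl fun σ _ => ?_
  rw [Finset.sum_congr rfl fun b _ => Finset.sum_comm, Finset.sum_comm]
  refine Finset.sum_congr rfl fun α _ => Finset.sum_congr rfl fun b _ =>
    Finset.sum_congr rfl fun a _ => ?_
  rw [Finset.prod_mul_distrib, map_prod, mul_assoc]
  congr 2
  rw [← Equiv.prod_comp σ fun i => conj (u ((α ∘ ⇑((Equiv.inv (Equiv.Perm (Fin k))) σ)) i) (b i))]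
  simp

lemma trace_mul_generalizedScroogeMoment (hH : H.IsHermitian) (Ψ₀ : EuclideanSpace ℂ (A × B))
    (x : OrthonormalBasis X ℂ (EuclideanSpace ℂ B)) (O : Matrix (Fin k → A) (Fin k → A) ℂ) :
    (O * generalizedScroogeMoment k hH Ψ₀ x).trace =
      wickSum O (fun j => pd hH Ψ₀ (x j)) fun j => scaledComponent hH Ψ₀ (x j) := by
  rw [generalizedScroogeMoment, Finset.mul_sum, Matrix.trace_sum]
  simp only [wickSum, meanForm]
  rw [Finset.sum_congr rfl fun σ _ => Finset.sum_comm, Finset.sum_comm]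
  refine Finset.sum_congr rfl fun j _ => ?_
  rw [Matrix.mul_smul, Matrix.trace_smul, trace_mul_scroogeMoment O _ _ (rhoBar_eq hH Ψ₀ (x j)),
    Complex.real_smul]
  simp only [Finset.mul_sum]

lemma exists_perm_of_noResonance {hH : H.IsHermitian} (hres : NoResonance hH (2 * k))
    (α β : Fin k ⊕ Fin k → energies hH) (hαβ : ∑ s, (α s : ℝ) = ∑ s, (β s : ℝ)) :
    ∃ π : Equiv.Perm (Fin k ⊕ Fin k), β = α ∘ π := by
  have hrep : ∀ e : energies hH, ∃ i, hH.eigenvalues i = e := fun e => by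
    obtain ⟨i, -, hi⟩ := Finset.mem_image.1 e.2
    exact ⟨i, hi⟩
  choose r hr using hrep
  let φ : Fin (2 * k) ≃ Fin k ⊕ Fin k := (finCongr (two_mul k)).trans finSumFinEquiv.symm
  obtain ⟨σ, hσ⟩ := hres (fun j => r (α (φ j))) (fun j => r (β (φ j))) (by
    simp only [hr]
    rw [Equiv.sum_comp φ fun s => (α s : ℝ), Equiv.sum_comp φ fun s => (β s : ℝ), hαβ])
  refine ⟨(φ.symm.trans σ).trans φ, ?_⟩
  ext s
  have h := hσ (φ.symm s)
  simp only [hr, Equiv.apply_symm_apply] at h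
  exact h

/-- Repeating each word twice gives words of length `2k` with equal sums. Their letter counts agree,
hence so do the halves. -/
lemma exists_perm_of_noResonance_half {hH : H.IsHermitian} (hres : NoResonance hH (2 * k))
    (α β : Fin k → energies hH) (hαβ : ∑ s, (α s : ℝ) = ∑ s, (β s : ℝ)) :
    ∃ π : Equiv.Perm (Fin k), β = α ∘ π := by
  obtain ⟨π, hπ⟩ := exists_perm_of_noResonance hres (Sum.elim α α) (Sum.elim β β) (by
    simp [Fintype.sum_sum_type, hαβ])
  refine exists_perm_of_card_fiber_eq fun m => ?_
  have hcard : ∀ γ : Fin k → energies hH,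
      (Finset.univ.filter fun s => Sum.elim γ γ s = m).card =
        2 * (Finset.univ.filter fun s => γ s = m).card := by
    intro γ
    rw [Finset.card_filter, Finset.card_filter, Fintype.sum_sum_type]
    simp only [Sum.elim_inl, Sum.elim_inr, two_mul]
    congr!
  have h := card_fiber_comp_perm (Sum.elim α α) π m
  rw [← hπ, hcard, hcard] at h
  omega

end Moments

/-! ### The trace norm -/

section TraceNorm

variable {n : Type*} [Fintype n] [DecidableEq n]

lemma sum_eigenvalues_conjTranspose_mul_self (M : Matrix n n ℂ) :
    ∑ i, (isHermitian_conjTranspose_mul_self M).eigenvalues i = ∑ b, ∑ a, ‖M b a‖ ^ 2 := by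
  have h := (isHermitian_conjTranspose_mul_self M).trace_eq_sum_eigenvalues
  have h2 : (Mᴴ * M).trace = ((∑ b, ∑ a, ‖M b a‖ ^ 2 : ℝ) : ℂ) := by
    simp only [Matrix.trace, Matrix.diag, Matrix.mul_apply, Matrix.conjTranspose_apply]
    rw [Finset.sum_comm]
    push_cast
    refine Finset.sum_congr rfl fun b _ => Finset.sum_congr rfl fun a _ => ?_
    rw [RCLike.star_def, Complex.conj_mul']
  rw [h2] at h
  have h3 : ((∑ b, ∑ a, ‖M b a‖ ^ 2 : ℝ) : ℂ) =
      ((∑ i, (isHermitian_conjTranspose_mul_self M).eigenvalues i : ℝ) : ℂ) := by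
    rw [h]; push_cast; rfl
  exact_mod_cast h3.symm

/-- Cauchy–Schwarz for the singular values, whose squares add up to the squared Frobenius norm. -/
lemma traceNorm_sq_le (M : Matrix n n ℂ) :
    traceNorm M ^ 2 ≤ Fintype.card n * ∑ b, ∑ a, ‖M b a‖ ^ 2 := by
  rw [← sum_eigenvalues_conjTranspose_mul_self]
  have h := sq_sum_le_card_mul_sum_sq (s := Finset.univ)
    (f := fun i => √((isHermitian_conjTranspose_mul_self M).eigenvalues i))
  refine h.trans (le_of_eq ?_)
  rw [Finset.card_univ]
  congr 1
  refine Finset.sum_congr rfl fun i _ => Real.sq_sqrt ?_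
  exact (posSemidef_conjTranspose_mul_self M).eigenvalues_nonneg i

lemma operatorNorm_single_le (b a : n) : operatorNorm (Matrix.single b a (1 : ℂ)) ≤ 1 := by
  refine ContinuousLinearMap.opNorm_le_bound _ zero_le_one fun v => ?_
  have h : Matrix.toEuclideanCLM (n := n) (𝕜 := ℂ) (Matrix.single b a (1 : ℂ)) v =
      EuclideanSpace.single b (v a) := by
    ext i
    simp [Matrix.ofLp_toEuclideanCLM, Matrix.single_mulVec, Function.update_apply]
  rw [h, one_mul, PiLp.norm_single]
  exact PiLp.norm_apply_le v a

lemma trace_single_mul (a b : n) (M : Matrix n n ℂ) :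
    (Matrix.single b a (1 : ℂ) * M).trace = M a b := by
  simp [Matrix.trace_single_mul]

lemma eq_zero_of_operatorNorm_eq_zero {O : Matrix n n ℂ} (h : operatorNorm O = 0) : O = 0 := by
  have := norm_eq_zero.1 h
  exact (Matrix.toEuclideanCLM (n := n) (𝕜 := ℂ)).injective (this.trans (map_zero _).symm)

end TraceNorm

lemma holdsExceptFraction_of_forall {δ : ℝ} (hδ : 0 < δ) {P : ℝ → Prop} (hP : ∀ t, P t) :
    HoldsExceptFraction δ P := by
  filter_upwards [eventually_ge_atTop 0] with T hT
  have : {t | t ∈ Set.Icc 0 T ∧ ¬ P t} = ∅ := by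
    ext t
    simp [hP t]
  rw [this, measureReal_empty]
  positivity

/-! ### The two bounds at typical late times -/

section Main

variable {A B X : Type*} [Fintype A] [DecidableEq A] [Fintype B] [DecidableEq B] [Fintype X]
  {H : Matrix (A × B) (A × B) ℂ} {k : ℕ}

/-- The long-time average of the mean square deviation of an observable. -/
lemma exists_tendsto_average_trace (hk : 1 ≤ k) {hH : H.IsHermitian}
    {Ψ₀ : EuclideanSpace ℂ (A × B)} (x : OrthonormalBasis X ℂ (EuclideanSpace ℂ B)) (hΨ : ‖Ψ₀‖ = 1)
    (hres : NoResonance hH (2 * k)) (O : Matrix (Fin k → A) (Fin k → A) ℂ) :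
    ∃ L ≤ deviationConst k * (operatorNorm O ^ 2 * deltaBeta hH Ψ₀ x),
      Tendsto (fun T : ℝ => T⁻¹ * ∫ t in (0 : ℝ)..T,
        ‖(O * (projectedMoment k hH Ψ₀ x t - generalizedScroogeMoment k hH Ψ₀ x)).trace‖ ^ 2)
        atTop (nhds L) := by
  obtain ⟨L, hL, hlim⟩ := exists_tendsto_average_deviation O
    (isOrthogonalFamily_scaledComponent hH hΨ x) (E := fun e : energies hH => (e : ℝ))
    (exists_perm_of_noResonance_half hres) (exists_perm_of_noResonance hres)
  rw [Fintype.card_fin, ← deltaBeta_eq] at hL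
  refine ⟨L, hL, ?_⟩
  simpa only [Matrix.mul_sub, Matrix.trace_sub, trace_mul_projectedMoment hk,
    trace_mul_generalizedScroogeMoment] using hlim

lemma continuous_trace (hk : 1 ≤ k) (hH : H.IsHermitian)
    (Ψ₀ : EuclideanSpace ℂ (A × B)) (x : OrthonormalBasis X ℂ (EuclideanSpace ℂ B))
    (O : Matrix (Fin k → A) (Fin k → A) ℂ) :
    Continuous fun t => (O * (projectedMoment k hH Ψ₀ x t -
      generalizedScroogeMoment k hH Ψ₀ x)).trace := by
  simp only [Matrix.mul_sub, Matrix.trace_sub, trace_mul_projectedMoment hk]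
  exact (continuous_phaseSum _ _).sub continuous_const

/-- Supplies the positive threshold and the strict inequality in Markov's argument. -/
lemma deltaBeta_pos {hH : H.IsHermitian} {Ψ₀ : EuclideanSpace ℂ (A × B)}
    (x : OrthonormalBasis X ℂ (EuclideanSpace ℂ B)) (hΨ : ‖Ψ₀‖ = 1) : 0 < deltaBeta hH Ψ₀ x := by
  have hfam := isOrthogonalFamily_scaledComponent hH hΨ x
  rw [deltaBeta_eq]
  have h0 : ∀ j, 0 ≤ pd hH Ψ₀ (x j) * ∑ e, sqNorm (scaledComponent hH Ψ₀ (x j) e) ^ 2 := fun j =>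
    mul_nonneg (hfam.nonneg j) (Finset.sum_nonneg fun _ _ => sq_nonneg _)
  obtain ⟨j, hj⟩ : ∃ j, pd hH Ψ₀ (x j) ≠ 0 := by
    by_contra! hc
    have := hfam.sum_weight
    simp [hc] at this
  obtain ⟨e, he⟩ : ∃ e, sqNorm (scaledComponent hH Ψ₀ (x j) e) ≠ 0 := by
    by_contra! hc
    refine hj ?_
    rw [pd_eq]
    refine Finset.sum_eq_zero fun e _ => ?_
    have := hc e
    rw [sqNorm_scaledComponent] at this
    exact (mul_eq_zero.1 this).resolve_left (inv_ne_zero hj)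
  refine Finset.sum_pos' (fun j _ => h0 j) ⟨j, Finset.mem_univ j, ?_⟩
  refine mul_pos ((hfam.nonneg j).lt_of_ne' hj) (Finset.sum_pos' (fun _ _ => sq_nonneg _)
    ⟨e, Finset.mem_univ e, by positivity⟩)

omit [DecidableEq A] [DecidableEq B] in
lemma card_pos_of_norm_eq_one {Ψ₀ : EuclideanSpace ℂ (A × B)} (hΨ : ‖Ψ₀‖ = 1) :
    1 ≤ Fintype.card A := by
  by_contra! hc
  have : IsEmpty A := Fintype.card_eq_zero_iff.1 (by omega)
  have : Ψ₀ = 0 := Subsingleton.elim _ _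
  simp [this] at hΨ

lemma holdsExceptFraction_trace (hk : 1 ≤ k) {hH : H.IsHermitian}
    {Ψ₀ : EuclideanSpace ℂ (A × B)} (x : OrthonormalBasis X ℂ (EuclideanSpace ℂ B)) (hΨ : ‖Ψ₀‖ = 1)
    (hres : NoResonance hH (2 * k)) {δ : ℝ} (hδ : 0 < δ) (O : Matrix (Fin k → A) (Fin k → A) ℂ) :
    HoldsExceptFraction δ (fun t =>
      ‖(O * (projectedMoment k hH Ψ₀ x t - generalizedScroogeMoment k hH Ψ₀ x)).trace‖ ≤
        √(deviationConst k + 1) * operatorNorm O * √(deltaBeta hH Ψ₀ x / δ)) := by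
  rcases (operatorNorm_nonneg O).eq_or_lt with hO | hO
  -- For `O = 0` the threshold is zero and Markov's argument does not apply, but the trace vanishes
  -- at all times.
  · refine holdsExceptFraction_of_forall hδ fun t => ?_
    rw [← hO, eq_zero_of_operatorNorm_eq_zero hO.symm]
    simp
  · have hΔ := deltaBeta_pos (hH := hH) x hΨ
    have hC := deviationConst_nonneg k
    obtain ⟨L, hL, hlim⟩ := exists_tendsto_average_trace hk x hΨ hres O
    refine holdsExceptFraction_of_tendsto ((continuous_trace hk hH Ψ₀ x O).norm.pow 2)
      (fun t => sq_nonneg _) hlim (c := √(deviationConst k + 1) * operatorNorm O *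
        √(deltaBeta hH Ψ₀ x / δ)) (by positivity) ?_ ?_
    · rw [mul_pow, mul_pow, Real.sq_sqrt (by positivity), Real.sq_sqrt (by positivity)]
      refine hL.trans_lt ?_
      have : 0 < operatorNorm O ^ 2 * deltaBeta hH Ψ₀ x := by positivity
      -- The `+ 1` in the constant provides the strict inequality.
      calc _ < deviationConst k * (operatorNorm O ^ 2 * deltaBeta hH Ψ₀ x) +
            operatorNorm O ^ 2 * deltaBeta hH Ψ₀ x := lt_add_of_pos_right _ this
        _ = _ := by field_simp
    · exact fun t ht => le_of_sq_le_sq ht (by positivity)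

lemma holdsExceptFraction_traceNorm (hk : 1 ≤ k) {hH : H.IsHermitian}
    {Ψ₀ : EuclideanSpace ℂ (A × B)} (x : OrthonormalBasis X ℂ (EuclideanSpace ℂ B)) (hΨ : ‖Ψ₀‖ = 1)
    (hres : NoResonance hH (2 * k)) {δ : ℝ} (hδ : 0 < δ) :
    HoldsExceptFraction δ (fun t =>
      traceNorm (projectedMoment k hH Ψ₀ x t - generalizedScroogeMoment k hH Ψ₀ x) ≤
        √(deviationConst k + 1) * (Fintype.card A : ℝ) ^ (2 * k) * √(deltaBeta hH Ψ₀ x / δ)) := by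
  have hΔ := deltaBeta_pos (hH := hH) x hΨ
  have hC := deviationConst_nonneg k
  have hD : (1 : ℝ) ≤ Fintype.card A := by exact_mod_cast card_pos_of_norm_eq_one hΨ
  set D : ℝ := (Fintype.card A : ℝ)
  have hcard : (Fintype.card (Fin k → A) : ℝ) = D ^ k := by
    rw [Fintype.card_fun, Fintype.card_fin]; push_cast; rfl
  set M : ℝ → Matrix (Fin k → A) (Fin k → A) ℂ := fun t =>
    projectedMoment k hH Ψ₀ x t - generalizedScroogeMoment k hH Ψ₀ x with hM
  -- Each entry is the trace against a matrix unit, of operator norm at most one. The squared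
  -- entries are summed before Markov's inequality, so there is one exceptional set and no union
  -- bound.
  have hent : ∀ b a : Fin k → A, ∃ L ≤ deviationConst k * deltaBeta hH Ψ₀ x,
      Tendsto (fun T : ℝ => T⁻¹ * ∫ t in (0 : ℝ)..T, ‖M t b a‖ ^ 2) atTop (nhds L) := by
    intro b a
    obtain ⟨L, hL, hlim⟩ := exists_tendsto_average_trace hk x hΨ hres (Matrix.single a b (1 : ℂ))
    simp only [trace_single_mul] at hlim
    refine ⟨L, hL.trans (mul_le_mul_of_nonneg_left ?_ hC), hlim⟩
    exact mul_le_of_le_one_left hΔ.le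
      (pow_le_one₀ (operatorNorm_nonneg _) (operatorNorm_single_le a b))
  have hcont : ∀ b a : Fin k → A, Continuous fun t => ‖M t b a‖ ^ 2 := by
    intro b a
    have h := continuous_trace hk hH Ψ₀ x (Matrix.single a b (1 : ℂ))
    simp only [trace_single_mul] at h
    exact h.norm.pow 2
  choose L hL hlim using hent
  have hlim' : Tendsto (fun T : ℝ => T⁻¹ * ∫ t in (0 : ℝ)..T, D ^ k * ∑ b, ∑ a, ‖M t b a‖ ^ 2) atTop
      (nhds (D ^ k * ∑ b, ∑ a, L b a)) := by
    have h1 : ∀ T : ℝ, T⁻¹ * ∫ t in (0 : ℝ)..T, D ^ k * ∑ b, ∑ a, ‖M t b a‖ ^ 2 =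
        D ^ k * ∑ b, ∑ a, T⁻¹ * ∫ t in (0 : ℝ)..T, ‖M t b a‖ ^ 2 := by
      intro T
      rw [intervalIntegral.integral_const_mul, intervalIntegral.integral_finsetSum]
      · rw [mul_left_comm, Finset.mul_sum]
        congr 1
        refine Finset.sum_congr rfl fun b _ => ?_
        rw [intervalIntegral.integral_finsetSum, Finset.mul_sum]
        exact fun a _ => (hcont b a).intervalIntegrable _ _
      · exact fun b _ => Continuous.intervalIntegrable
          (continuous_finsetSum _ fun a _ => hcont b a) _ _
    simp only [h1]
    exact (tendsto_finsetSum _ fun b _ => tendsto_finsetSum _ fun a _ => hlim b a).const_mul _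
  refine holdsExceptFraction_of_tendsto (continuous_const.mul (continuous_finsetSum _ fun b _ =>
    continuous_finsetSum _ fun a _ => hcont b a)) (fun t => mul_nonneg
      (by positivity) (Finset.sum_nonneg fun _ _ => Finset.sum_nonneg fun _ _ => sq_nonneg _)) hlim'
    (c := √(deviationConst k + 1) * D ^ (2 * k) * √(deltaBeta hH Ψ₀ x / δ)) (by positivity) ?_ ?_
  · rw [mul_pow, mul_pow, Real.sq_sqrt (by positivity), Real.sq_sqrt (by positivity)]
    calc D ^ k * ∑ b, ∑ a, L b a
        ≤ D ^ k * ∑ _b : Fin k → A, ∑ _a : Fin k → A, deviationConst k * deltaBeta hH Ψ₀ x := by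
          gcongr with b _ a _
          exact hL b a
      -- There are `D ^ (2 * k)` entries, and `D ^ k` comes from Cauchy–Schwarz. The squared
      -- threshold allows `D ^ (4 * k)`, which is larger because `D ≥ 1`.
      _ = D ^ (3 * k) * (deviationConst k * deltaBeta hH Ψ₀ x) := by
          simp only [Finset.sum_const, Finset.card_univ, nsmul_eq_mul, hcard]
          ring
      _ < D ^ (3 * k) * ((deviationConst k + 1) * deltaBeta hH Ψ₀ x) := by
          gcongr
          linarith
      _ ≤ D ^ (2 * k * 2) * ((deviationConst k + 1) * deltaBeta hH Ψ₀ x) := by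
          refine mul_le_mul_of_nonneg_right (pow_le_pow_right₀ hD (by omega)) (by positivity)
      _ = _ := by
          field_simp
          ring
  · intro t ht
    refine le_of_sq_le_sq (le_trans ?_ ht) (by positivity)
    rw [← hcard]
    exact traceNorm_sq_le _

end Main

end ProjectedEnsemble

theorem theorem4 (k : ℕ) (hk : 1 ≤ k) :
    ∃ C : ℝ, 0 < C ∧
      ∀ (A B X : Type*) [Fintype A] [DecidableEq A] [Fintype B] [DecidableEq B] [Fintype X]
        (H : Matrix (A × B) (A × B) ℂ) (hH : H.IsHermitian)
        (Ψ₀ : EuclideanSpace ℂ (A × B)) (x : OrthonormalBasis X ℂ (EuclideanSpace ℂ B)),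
        ‖Ψ₀‖ = 1 → NoResonance hH (2 * k) →
        ∀ δ : ℝ, 0 < δ →
          HoldsExceptFraction δ (fun t =>
            traceNorm (projectedMoment k hH Ψ₀ x t - generalizedScroogeMoment k hH Ψ₀ x) ≤
              C * (Fintype.card A : ℝ) ^ (2 * k) * √(deltaBeta hH Ψ₀ x / δ)) ∧
          ∀ O : Matrix (Fin k → A) (Fin k → A) ℂ,
            HoldsExceptFraction δ (fun t =>
              ‖(O * (projectedMoment k hH Ψ₀ x t -
                  generalizedScroogeMoment k hH Ψ₀ x)).trace‖ ≤
                C * operatorNorm O * √(deltaBeta hH Ψ₀ x / δ)) := by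
  refine ⟨√(deviationConst k + 1), Real.sqrt_pos.2 (by linarith [deviationConst_nonneg k]), ?_⟩
  intro A B X _ _ _ _ _ H hH Ψ₀ x hΨ hres δ hδ
  exact ⟨holdsExceptFraction_traceNorm hk x hΨ hres hδ, holdsExceptFraction_trace hk x hΨ hres hδ⟩
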